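/- For positive integers $a,d,c$ and an integer $k\ge 2$ let $\mathcal S=\langle a,a+d,\ldots,a+kd,c\rangle\subseteq\mathbb Z$ be the set of all non-negative integer linear combinations of $a,a+d,\ldots,a+kd,c$ (an AA-semigroup). Let $g$ be the Frobenius number of $\mathcal S$, i.e. the largest integer not in $\mathcal S$ (it exists iff the generators are relatively prime). $\mathcal S$ is called pseudo-symmetric if $g$ exists, is even, and $\mathcal S\cup(g-\mathcal S)=\mathbb Z\setminus\{g/2\}$, where $g-\mathcal S=\{g-s : s\in\mathcal S\}$. Then $\mathcal S$ is pseudo-symmetric if and only if $\gcd(a,d)=1$ and one of the following conditions holds: (a) $\mathcal S=\langle 3,3+d,3+2d\rangle$; (b) $a(c-1)=2(c+d)$ with $c$ odd; (c.1) $a\equiv 1$ or $5\pmod 6$, $c(a-3)=6d$, and $a\le 2kd+3$; (c.2) there exist integers $\lambda,\mu\ge1$ and $m\ge1$ such that $a=(2+\lambda k)(m+1)+1$, $c+(2+\lambda k)d=\mu a$, and $a+kd=\dfrac{cm-3d}{\lambda}$; (d) there exist integers $\lambda\ge2$, $\mu\ge1$ and $v\ge0$ such that $a=(v+1)(2+(\lambda-2)k)+(\lambda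 k+1)$, $c+(2+(\lambda-2)k)d=\mu a$, and $a+kd=\dfrac{c(v+1)-d}{\lambda}$; (e) there exist integers $q_1\ge2$, $R_0\equiv2\pmod k$ and $s_0\equiv2\pmod k$ such that $a=(q_1-1)s_0+1$, $a+kd=q_1R_0+2k-1$, and $kc=(R_0+2k-1)(s_0-1)+2k-1$; (f) there exist integers $q_1\ge2$, $R_0\equiv2\pmod k$ and $s_0\equiv2\pmod k$ with $s_0\ne2$ such that $a=(q_1-1)s_0+3$, $a+kd=q_1R_0+1$, and $kc=(R_0+1)(s_0-3)+3$. Moreover, there are pseudo-symmetric AA-semigroups with arbitrarily many generators: for every $n$ there are positive integers $a,d,c$ and $k\ge2$ such that $\mathcal S=\langle a,a+d,\ldots,a+kd,c\rangle$ is pseudo-symmetric and cannot be generated by fewer than $n$ elements. -/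

import Mathlib

/-- The semigroup `⟨a, a + d, …, a + k d, c⟩` of all non-negative integer linear combinations,
as a submonoid of `ℤ`. -/
def AASemigroup (a d k c : ℤ) : AddSubmonoid ℤ :=
  AddSubmonoid.closure ({x : ℤ | ∃ i : ℤ, 0 ≤ i ∧ i ≤ k ∧ x = a + i * d} ∪ {c})

/-- `g` is the Frobenius number of `S`: the largest integer that is not in `S`. -/
def IsFrobenius (S : AddSubmonoid ℤ) (g : ℤ) : Prop :=
  IsGreatest {x : ℤ | x ∉ S} g

/-- `S` is pseudo-symmetric: its Frobenius number `g` exists, is even, and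
`S ∪ (g - S) = ℤ \ {g / 2}`. -/
def IsPseudoSymmetric (S : AddSubmonoid ℤ) : Prop :=
  ∃ g : ℤ, IsFrobenius S g ∧ Even g ∧
    (S : Set ℤ) ∪ {x : ℤ | ∃ s ∈ S, x = g - s} = Set.univ \ {g / 2}

/-! ### Membership in the semigroup -/

/-! Elements of S are the numbers a n + d y + c z with 0 ≤ y ≤ k n and z ≥ 0, so for given (y, z)
the best choice is n = ⌈y/k⌉, which yields `weight`. If gcd(a, d) = 1, the residues mod a are ℤ²
modulo the lattice a ∣ d y + c z. This lattice has an L-shaped fundamental domain whose weights form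
the Apéry set of S with respect to a (`exists_lShape`, `LShape.weight_sub_mem_iff`). Pseudo-symmetry
becomes a statement about that finite set: apart from one element, equal to g/2 + a, the Apéry set
splits into pairs with sum g + a, its maximum (`Paired`).

Weights grow in both coordinates, so the maximum sits at one of the two outer corners of the L
(`Paired.corner`). The rectangle below it is paired by a point reflection, and the rest of the L by
a point reflection composed with a lattice shift. The part d y + c z is additive, so the pairing
only constrains ceilings. Below the top this forces k ∣ Y - 1, or Y = 0, or a tiny row centred at
the exceptional point (`Paired.below_top`). In the rest of the L the exceptional point is the
centre, where the ceilings are off by one, and this leaves only a single row of length 1 or 3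
(`Paired.right_corner`), or 1 or 2k - 1 (`Paired.upper_corner`).

Reading off W, w, H, h gives the families: (e), (f) from the right corner, (c), (d) from the upper
one, (a), (b) from the degenerate widths. Conversely each family dictates its L. Coprimality of a
and d is a separate argument (`IsPseudoSymmetric.gcd_eq_one`), and (f) with q₁ = 2, R₀ = s₀ = k + 2
supplies semigroups with many generators. -/

theorem AASemigroup.add_mem_of_le {a d k c : ℤ} (hk : 0 ≤ k) (n : ℕ) :
    ∀ y : ℤ, 0 ≤ y → y ≤ k * n → a * n + d * y ∈ AASemigroup a d k c := by
  induction n with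
  | zero =>
    intro y h0 h1
    obtain rfl : y = 0 := by simp at h1; omega
    simp
  | succ n ih =>
    intro y h0 h1
    push_cast at h1 ⊢
    have hn : 0 ≤ k * n := by positivity
    have h1' : y ≤ k * n + k := by linarith
    -- Greedy choice: the next generator absorbs as much of y as the index bound k allows.
    have hgen : a + min y k * d ∈ AASemigroup a d k c :=
      AddSubmonoid.subset_closure (Or.inl ⟨min y k, by simp [h0, hk], by simp, rfl⟩)
    have hrest := ih (y - min y k) (by simp) (by rcases min_choice y k with h | h <;> omega)
    convert add_mem hgen hrest using 1
    ring

/-- Here n counts the generators taken from the progression and y is the sum of their indices; every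
y between 0 and k n occurs. -/
theorem AASemigroup.mem_iff {a d k c x : ℤ} (hk : 0 < k) :
    x ∈ AASemigroup a d k c ↔
      ∃ n y z : ℤ, 0 ≤ y ∧ y ≤ k * n ∧ 0 ≤ z ∧ x = a * n + d * y + c * z := by
  constructor
  · intro hx
    induction hx using AddSubmonoid.closure_induction with
    | mem x hx =>
      rcases hx with ⟨i, h0, h1, rfl⟩ | rfl
      · exact ⟨1, i, 0, h0, by simpa using h1, le_rfl, by ring⟩
      · exact ⟨0, 0, 1, le_rfl, by simp, by norm_num, by ring⟩
    | zero => exact ⟨0, 0, 0, by simp⟩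
    | add x y _ _ hx hy =>
      obtain ⟨n, y, z, h0, h1, h2, rfl⟩ := hx
      obtain ⟨n', y', z', h0', h1', h2', rfl⟩ := hy
      exact ⟨n + n', y + y', z + z', by omega, by linarith, by omega, by ring⟩
  · rintro ⟨n, y, z, h0, h1, h2, rfl⟩
    have hn : 0 ≤ n := by
      by_contra h
      have : k * n < 0 := mul_neg_of_pos_of_neg hk (by omega)
      omega
    lift n to ℕ using hn
    lift z to ℕ using h2
    refine add_mem (AASemigroup.add_mem_of_le hk.le n y h0 h1) ?_
    have hc : c ∈ AASemigroup a d k c := AddSubmonoid.subset_closure (Or.inr rfl)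
    have := nsmul_mem hc z
    rwa [nsmul_eq_mul, mul_comm] at this

theorem AASemigroup.nonneg_of_mem {a d k c x : ℤ} (ha : 0 < a) (hd : 0 < d) (hc : 0 < c)
    (hk : 0 < k) (hx : x ∈ AASemigroup a d k c) : 0 ≤ x := by
  obtain ⟨n, y, z, h0, h1, h2, rfl⟩ := (AASemigroup.mem_iff hk).1 hx
  have hn : 0 ≤ n := by
    by_contra h
    have : k * n < 0 := mul_neg_of_pos_of_neg hk (by omega)
    omega
  positivity

/-! ### A pseudo-symmetric semigroup forces `gcd (a, d) = 1` -/

/-- In any representation the number m of copies of c is congruent to z mod h; since m ≥ 0 and z <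
h, at least z copies are present and z of them can be removed. -/
theorem AASemigroup.dvd_mul_mem_of_add_mem {a d k c h s z : ℤ} (hk : 0 < k)
    (ha : h ∣ a) (hd : h ∣ d) (hhc : IsCoprime h c) (hz : z < h)
    (hmem : h * s + c * z ∈ AASemigroup a d k c) : h * s ∈ AASemigroup a d k c := by
  obtain ⟨n, y, m, h0, h1, h2, he⟩ := (AASemigroup.mem_iff hk).1 hmem
  obtain ⟨a', rfl⟩ := ha
  obtain ⟨d', rfl⟩ := hd
  have hdvd : h ∣ m - z := by
    refine hhc.dvd_of_dvd_mul_left ⟨s - a' * n - d' * y, ?_⟩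
    linear_combination -he
  have hmz : 0 ≤ m - z := by
    obtain ⟨e, he'⟩ := hdvd
    by_contra hneg
    have he0 : e ≤ -1 ∨ 0 ≤ e := by omega
    rcases he0 with he0 | he0
    · have hh : 0 < h := by
        by_contra hh
        have : 0 ≤ h * e := mul_nonneg_of_nonpos_of_nonpos (by omega) (by omega)
        omega
      have : h * e ≤ h * (-1) := mul_le_mul_of_nonneg_left he0 hh.le
      omega
    · have hh : h < 0 := by
        by_contra hh
        have : 0 ≤ h * e := mul_nonneg (by omega) he0
        omega
      omega
  exact (AASemigroup.mem_iff hk).2 ⟨n, y, m - z, h0, h1, hmz, by linear_combination he⟩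

theorem AASemigroup.mul_add_mem {a d k c x z : ℤ}
    (hz : 0 ≤ z) (hx : x ∈ AASemigroup a d k c) : x + c * z ∈ AASemigroup a d k c := by
  have hc : c ∈ AASemigroup a d k c := AddSubmonoid.subset_closure (Or.inr rfl)
  lift z to ℕ using hz
  have := nsmul_mem hc z
  rw [nsmul_eq_mul, mul_comm] at this
  exact add_mem hx this

theorem exists_eq_mul_add_mul_of_isCoprime {h c : ℤ} (hh : 0 < h) (hhc : IsCoprime h c) (x : ℤ) :
    ∃ s z : ℤ, 0 ≤ z ∧ z < h ∧ x = h * s + c * z := by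
  obtain ⟨u, v, huv⟩ := hhc
  refine ⟨x * u + c * ((x * v) / h), (x * v) % h, Int.emod_nonneg _ hh.ne', Int.emod_lt_of_pos _ hh,
    ?_⟩
  have := Int.emod_add_mul_ediv (x * v) h
  linear_combination (-x) * huv - c * this

theorem union_sub_eq_univ_diff_iff {S : AddSubmonoid ℤ} {g : ℤ} :
    ((S : Set ℤ) ∪ {x : ℤ | ∃ s ∈ S, x = g - s} = Set.univ \ {g / 2}) ↔
      ∀ x, (x ∈ S ∨ g - x ∈ S) ↔ x ≠ g / 2 := by
  rw [Set.ext_iff]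
  refine forall_congr' fun x => ?_
  simp only [Set.mem_union, SetLike.mem_coe, Set.mem_ofPred_eq, Set.mem_sdiff, Set.mem_univ,
    Set.mem_singleton_iff, true_and]
  refine iff_congr (or_congr_right ⟨?_, fun h => ⟨_, h, by ring⟩⟩) Iff.rfl
  rintro ⟨s, hs, rfl⟩
  simpa using hs

/-- Let h = gcd(a, d) > 1. Writing x = h s + c z with 0 ≤ z < h, membership in S depends on s alone.
Maximality gives g the coordinate z = h - 1, so reflection in g preserves this normal form. Changing
only the z of g/2 gives another integer; it or its reflection lies in S, hence so does g/2, a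
contradiction. -/
theorem IsPseudoSymmetric.gcd_eq_one {a d k c : ℤ} (ha : 0 < a) (hc : 0 < c) (hk : 0 < k)
    (hS : IsPseudoSymmetric (AASemigroup a d k c)) : Int.gcd a d = 1 := by
  obtain ⟨g, ⟨hg, hmax⟩, ⟨e, hge⟩, hcov⟩ := hS
  rw [union_sub_eq_univ_diff_iff] at hcov
  have hmax : ∀ x, g < x → x ∈ AASemigroup a d k c := fun x hx => by
    by_contra h
    exact absurd (hmax h) (by omega)
  have hg2 : g / 2 = e := by omega
  rw [hg2] at hcov
  set h : ℤ := (Int.gcd a d : ℤ) with hdef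
  have hha : h ∣ a := Int.gcd_dvd_left ..
  have hhd : h ∣ d := Int.gcd_dvd_right ..
  have hpos : 0 < h := by
    have := Int.gcd_pos_of_ne_zero_left d ha.ne'
    omega
  by_contra hne
  have h2 : 2 ≤ h := by omega
  have hhc : IsCoprime h c := by
    have key : ∀ x ∈ AASemigroup a d k c, (Int.gcd h c : ℤ) ∣ x := by
      intro x hx
      obtain ⟨n, y, z, -, -, -, rfl⟩ := (AASemigroup.mem_iff hk).1 hx
      have h1 : (Int.gcd h c : ℤ) ∣ h := Int.gcd_dvd_left ..
      exact dvd_add (dvd_add ((h1.trans hha).mul_right _) ((h1.trans hhd).mul_right _))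
        ((Int.gcd_dvd_right ..).mul_right _)
    have h1 := dvd_sub (key (g + 2) (hmax _ (by omega))) (key (g + 1) (hmax _ (by omega)))
    rw [show g + 2 - (g + 1) = 1 by ring] at h1
    rw [Int.isCoprime_iff_gcd_eq_one]
    exact_mod_cast Int.eq_one_of_dvd_one (by positivity) h1
  obtain ⟨s, z, hz0, hz1, hez⟩ := exists_eq_mul_add_mul_of_isCoprime hpos hhc e
  obtain ⟨G, w, hw0, hw1, hgw⟩ := exists_eq_mul_add_mul_of_isCoprime hpos hhc g
  have hgS : g ∉ AASemigroup a d k c := hg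
  -- Otherwise raising w to h - 1 gives a number above g, hence in S, and lowering it again puts g
  -- in S.
  obtain rfl : w = h - 1 := by
    by_contra hne
    have hlt : c * w < c * (h - 1) := mul_lt_mul_of_pos_left (by omega) hc
    have := AASemigroup.dvd_mul_mem_of_add_mem hk hha hhd hhc (by omega)
      (hmax (h * G + c * (h - 1)) (by omega))
    exact hgS (hgw ▸ AASemigroup.mul_add_mem hw0 this)
  have heS : e ∉ AASemigroup a d k c := fun h => (hcov e).1 (Or.inl h) rfl
  obtain ⟨z', hz0', hz1', hzz⟩ : ∃ z' : ℤ, 0 ≤ z' ∧ z' < h ∧ z' ≠ z := by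
    by_cases hz : z = 0
    · exact ⟨1, by omega, by omega, by omega⟩
    · exact ⟨0, by omega, by omega, by omega⟩
  have hx : h * s + c * z' ≠ e := by
    rw [hez]
    intro h
    exact hzz (mul_left_cancel₀ hc.ne' (add_left_cancel h))
  rcases (hcov _).2 hx with hm | hm
  · have := AASemigroup.dvd_mul_mem_of_add_mem hk hha hhd hhc hz1' hm
    exact heS (hez ▸ AASemigroup.mul_add_mem hz0 this)
  · rw [show g - (h * s + c * z') = h * (G - s) + c * (h - 1 - z') by
      linear_combination hgw] at hm
    have := AASemigroup.dvd_mul_mem_of_add_mem hk hha hhd hhc (by omega) hm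
    have h3 := AASemigroup.mul_add_mem (z := h - 1 - z) (by omega) this
    apply heS
    convert h3 using 1
    linear_combination hgw - hge - hez

/-! ### Ceiling division -/

/-- `⌈y / k⌉`. -/
def cdiv (y k : ℤ) : ℤ := -(-y / k)

theorem cdiv_le_iff {y k n : ℤ} (hk : 0 < k) : cdiv y k ≤ n ↔ y ≤ k * n := by
  unfold cdiv
  rw [neg_le, Int.le_ediv_iff_mul_le hk]
  constructor <;> intro h <;> linarith

theorem cdiv_eq {y k n : ℤ} (hk : 0 < k) (h1 : k * (n - 1) < y) (h2 : y ≤ k * n) :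
    cdiv y k = n := by
  refine le_antisymm ((cdiv_le_iff hk).2 h2) ?_
  by_contra h
  have : y ≤ k * (n - 1) := (cdiv_le_iff hk).1 (by omega)
  omega

theorem le_mul_cdiv {y k : ℤ} (hk : 0 < k) : y ≤ k * cdiv y k := (cdiv_le_iff hk).1 le_rfl

theorem mul_cdiv_lt {y k : ℤ} (hk : 0 < k) : k * cdiv y k < y + k := by
  by_contra h
  have : cdiv y k ≤ cdiv y k - 1 := (cdiv_le_iff hk).2 (by linarith)
  omega

theorem cdiv_mono {y y' k : ℤ} (hk : 0 < k) (h : y ≤ y') : cdiv y k ≤ cdiv y' k :=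
  (cdiv_le_iff hk).2 (h.trans (le_mul_cdiv hk))

@[simp] theorem cdiv_zero_left (k : ℤ) : cdiv 0 k = 0 := by simp [cdiv]

theorem cdiv_one {k : ℤ} (hk : 0 < k) : cdiv 1 k = 1 := cdiv_eq hk (by simp) (by omega)

theorem cdiv_two {k : ℤ} (hk : 2 ≤ k) : cdiv 2 k = 1 := cdiv_eq (by omega) (by simp) (by omega)

theorem cdiv_add_mul {y k i : ℤ} (hk : 0 < k) : cdiv (y + i * k) k = cdiv y k + i :=
  cdiv_eq hk (by linarith [mul_cdiv_lt (y := y) hk]) (by linarith [le_mul_cdiv (y := y) hk])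

/-- The ceiling jumps only just after a multiple of k. -/
theorem dvd_of_cdiv_sub_one {y k : ℤ} (hk : 0 < k) (h : cdiv (y - 1) k < cdiv y k) :
    k ∣ y - 1 := by
  have h1 := le_mul_cdiv (y := y - 1) hk
  have h2 := mul_cdiv_lt (y := y) hk
  have h3 : k * (cdiv (y - 1) k + 1) ≤ k * cdiv y k := mul_le_mul_of_nonneg_left h hk.le
  exact ⟨cdiv (y - 1) k, by linarith⟩

/-- After removing the multiple of k from Y - 1, this is ⌈(1 - y)/k⌉ = 1 - ⌈y/k⌉. It is what makes
reflection below the top compatible with weights. -/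
theorem cdiv_add_cdiv_sub {y Y k : ℤ} (hk : 0 < k) (hY : k ∣ Y - 1) :
    cdiv y k + cdiv (Y - y) k = cdiv Y k := by
  obtain ⟨m, hm⟩ := hY
  obtain rfl : Y = 1 + m * k := by linarith
  rw [cdiv_add_mul hk, cdiv_one hk]
  have h1 := le_mul_cdiv (y := y) hk
  have h2 := mul_cdiv_lt (y := y) hk
  rw [cdiv_eq (y := 1 + m * k - y) (n := m + 1 - cdiv y k) hk (by linarith) (by linarith)]
  ring

/-! ### L-shaped fundamental regions -/

/-- The rectangle `[0, W) × [0, H)` without the upper right corner of size `w × h`. -/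
def LRegion (W w H h y z : ℤ) : Prop :=
  0 ≤ y ∧ y < W ∧ 0 ≤ z ∧ z < H ∧ (y < W - w ∨ z < H - h)

/-- The smallest element `a ⌈y / k⌉ + d y + c z` of the semigroup of the form `a n + d y + c z`. -/
def weight (a d k c y z : ℤ) : ℤ := a * cdiv y k + d * y + c * z

/-- The L-shaped region given by `W, w, H, h` is a fundamental domain of the lattice
`{(y, z) | a ∣ d y + c z}`, in which every point minimizes `(a + k d) y + k c z` among the
points of the first quadrant in its class. -/
structure LShape (a d k c W w H h : ℤ) : Prop where
  w_nonneg : 0 ≤ w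
  w_lt : w < W
  h_nonneg : 0 ≤ h
  h_lt : h < H
  area : W * H - w * h = a
  dvd_right : a ∣ d * W - c * h
  dvd_up : a ∣ c * H - d * w
  right_nonneg : 0 ≤ (a + k * d) * W - k * c * h
  up_nonneg : 0 ≤ k * c * H - (a + k * d) * w

/-- Cramer's rule for the lattice vectors (W, -h) and (-w, H), whose determinant is a; coprimality
with d makes the numerators divisible by a. -/
theorem LShape.exists_coords {a d k c W w H h y z : ℤ} (hL : LShape a d k c W w H h)
    (ha : 0 < a) (hg : IsCoprime a d) (hyz : a ∣ d * y + c * z) :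
    ∃ i j : ℤ, y = i * W - j * w ∧ z = j * H - i * h := by
  have h1 : a ∣ H * y + w * z := by
    refine hg.dvd_of_dvd_mul_left ?_
    have := dvd_sub (hyz.mul_left H) (hL.dvd_up.mul_left z)
    convert this using 1
    ring
  have h2 : a ∣ h * y + W * z := by
    refine hg.dvd_of_dvd_mul_left ?_
    have := dvd_add (hyz.mul_left h) (hL.dvd_right.mul_left z)
    convert this using 1
    ring
  obtain ⟨i, hi⟩ := h1
  obtain ⟨j, hj⟩ := h2
  have har := hL.area
  refine ⟨i, j, mul_left_cancel₀ ha.ne' ?_, mul_left_cancel₀ ha.ne' ?_⟩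
  · linear_combination W * hi - w * hj - y * har
  · linear_combination H * hj - h * hi - z * har

/-- A negative i would push y' below 0 unless j ≤ i, and symmetrically. So a negative coefficient
forces i = j < 0, a step back by a multiple of (W - w, H - h), which leaves the quadrant because the
corner is cut out of the region. -/
theorem LShape.coords_nonneg {a d k c W w H h y z y' z' i j : ℤ} (hL : LShape a d k c W w H h)
    (hp : LRegion W w H h y z) (hy' : 0 ≤ y') (hz' : 0 ≤ z')
    (hy : y' - y = i * W - j * w) (hz : z' - z = j * H - i * h) : 0 ≤ i ∧ 0 ≤ j := by
  obtain ⟨hw0, hw1, hh0, hh1, -, -, -, -, -⟩ := hL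
  obtain ⟨p0, p1, p2, p3, p4⟩ := hp
  have hj_of : i ≤ -1 → j ≤ i := by
    intro hi
    by_contra hj
    have h1 : w * (i + 1) ≤ w * j := mul_le_mul_of_nonneg_left (by omega) hw0
    have h2 : (W - w) * (i + 1) ≤ 0 := mul_nonpos_of_nonneg_of_nonpos (by omega) (by omega)
    nlinarith
  have hi_of : j ≤ -1 → i ≤ j := by
    intro hi
    by_contra hj
    have h1 : h * (j + 1) ≤ h * i := mul_le_mul_of_nonneg_left (by omega) hh0
    have h2 : (H - h) * (j + 1) ≤ 0 := mul_nonpos_of_nonneg_of_nonpos (by omega) (by omega)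
    nlinarith
  by_contra hne
  have hij : i = j ∧ i ≤ -1 := by omega
  obtain ⟨rfl, hi⟩ := hij
  have h1 : (W - w) * (i + 1) ≤ 0 := mul_nonpos_of_nonneg_of_nonpos (by omega) (by omega)
  have h2 : (H - h) * (i + 1) ≤ 0 := mul_nonpos_of_nonneg_of_nonpos (by omega) (by omega)
  rcases p4 with p4 | p4 <;> nlinarith

theorem LShape.eq_of_dvd {a d k c W w H h y z y' z' : ℤ} (hL : LShape a d k c W w H h)
    (ha : 0 < a) (hg : IsCoprime a d) (hp : LRegion W w H h y z) (hq : LRegion W w H h y' z')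
    (hdvd : a ∣ d * (y' - y) + c * (z' - z)) : y' = y ∧ z' = z := by
  obtain ⟨i, j, hy, hz⟩ := hL.exists_coords ha hg hdvd
  obtain ⟨h1, h2⟩ := hL.coords_nonneg hp hq.1 hq.2.2.1 hy hz
  obtain ⟨h3, h4⟩ := hL.coords_nonneg (i := -i) (j := -j) hq hp.1 hp.2.2.1
    (by linear_combination -hy) (by linear_combination -hz)
  obtain rfl : i = 0 := by omega
  obtain rfl : j = 0 := by omega
  constructor <;> linarith

theorem LShape.weight_le {a d k c W w H h y z n y' z' : ℤ} (hL : LShape a d k c W w H h)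
    (ha : 0 < a) (hk : 0 < k) (hg : IsCoprime a d) (hp : LRegion W w H h y z)
    (hy' : 0 ≤ y') (hn : y' ≤ k * n) (hz' : 0 ≤ z')
    (hdvd : a ∣ d * (y' - y) + c * (z' - z)) :
    weight a d k c y z ≤ a * n + d * y' + c * z' := by
  obtain ⟨i, j, hy, hz⟩ := hL.exists_coords ha hg hdvd
  obtain ⟨h1, h2⟩ := hL.coords_nonneg hp hy' hz' hy hz
  obtain ⟨e, he⟩ := hdvd
  have hlin : 0 ≤ (a + k * d) * (y' - y) + k * c * (z' - z) := by
    rw [hy, hz]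
    have := add_nonneg (mul_nonneg h1 hL.right_nonneg) (mul_nonneg h2 hL.up_nonneg)
    linarith
  -- On lattice vectors the linear form is a multiple of a, so dividing by a bounds y by y' + k e,
  -- hence its ceiling by n + e.
  have hlin' : 0 ≤ (y' - y) + k * e := by
    have : (a + k * d) * (y' - y) + k * c * (z' - z) = a * ((y' - y) + k * e) := by
      linear_combination k * he
    rw [this] at hlin
    exact nonneg_of_mul_nonneg_right hlin ha
  have hce : cdiv y k ≤ n + e := (cdiv_le_iff hk).2 (by linarith)
  have := mul_le_mul_of_nonneg_left hce ha.le
  unfold weight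
  linarith

theorem weight_mem {a d k c y z : ℤ} (hk : 0 < k) (hy : 0 ≤ y) (hz : 0 ≤ z) :
    weight a d k c y z ∈ AASemigroup a d k c :=
  (AASemigroup.mem_iff hk).2 ⟨_, y, z, hy, le_mul_cdiv hk, hz, rfl⟩

/-- The weights on the region are thus the least elements of S in their classes mod a: the Apéry
set. -/
theorem LShape.weight_sub_mem_iff {a d k c W w H h y z m : ℤ} (hL : LShape a d k c W w H h)
    (ha : 0 < a) (hk : 0 < k) (hg : IsCoprime a d) (hp : LRegion W w H h y z) :
    weight a d k c y z + a * m ∈ AASemigroup a d k c ↔ 0 ≤ m := by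
  constructor
  · intro hm
    obtain ⟨n, y', z', h0, h1, h2, he⟩ := (AASemigroup.mem_iff hk).1 hm
    have := hL.weight_le ha hk hg hp h0 h1 h2
      ⟨cdiv y k + m - n, by unfold weight at he; linear_combination -he⟩
    by_contra hm
    have : a * m < 0 := mul_neg_of_pos_of_neg ha (by omega)
    omega
  · intro hm
    have h1 : weight a d k c y z ∈ AASemigroup a d k c := weight_mem hk hp.1 hp.2.2.1
    have h2 : a * m ∈ AASemigroup a d k c :=
      (AASemigroup.mem_iff hk).2 ⟨m, 0, 0, le_rfl, by positivity, le_rfl, by ring⟩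
    exact add_mem h1 h2

/-- The L-shaped region as a finite set. -/
noncomputable def lFinset (W w H h : ℤ) : Finset (ℤ × ℤ) :=
  (Finset.Ico 0 W ×ˢ Finset.Ico 0 H) \ (Finset.Ico (W - w) W ×ˢ Finset.Ico (H - h) H)

theorem mem_lFinset {W w H h : ℤ} {p : ℤ × ℤ} :
    p ∈ lFinset W w H h ↔ LRegion W w H h p.1 p.2 := by
  simp only [lFinset, LRegion, Finset.mem_sdiff, Finset.mem_product, Finset.mem_Ico]
  omega

theorem card_lFinset {W w H h : ℤ} (hw : 0 ≤ w) (hwW : w < W) (hh : 0 ≤ h) (hhH : h < H) :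
    ((lFinset W w H h).card : ℤ) = W * H - w * h := by
  have hsub : Finset.Ico (W - w) W ×ˢ Finset.Ico (H - h) H ⊆
      Finset.Ico 0 W ×ˢ Finset.Ico 0 H :=
    Finset.product_subset_product (Finset.Ico_subset_Ico (by omega) le_rfl)
      (Finset.Ico_subset_Ico (by omega) le_rfl)
  rw [lFinset, Finset.card_sdiff_of_subset hsub, Nat.cast_sub (Finset.card_le_card hsub)]
  simp only [Finset.card_product, Int.card_Ico, Nat.cast_mul]
  rw [Int.toNat_of_nonneg (by omega), Int.toNat_of_nonneg (by omega),
    Int.toNat_of_nonneg (by omega), Int.toNat_of_nonneg (by omega)]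
  ring

/-- The region has a points, pairwise incongruent, so it meets every residue class mod a. -/
theorem LShape.exists_eq {a d k c W w H h : ℤ} (hL : LShape a d k c W w H h)
    (ha : 0 < a) (hg : IsCoprime a d) (x : ℤ) :
    ∃ y z m : ℤ, LRegion W w H h y z ∧ x = weight a d k c y z + a * m := by
  have himg : (lFinset W w H h).image (fun p => (d * p.1 + c * p.2) % a) = Finset.Ico 0 a := by
    refine Finset.eq_of_subset_of_card_le ?_ ?_
    · intro r hr
      obtain ⟨p, -, rfl⟩ := Finset.mem_image.1 hr
      exact Finset.mem_Ico.2 ⟨Int.emod_nonneg _ ha.ne', Int.emod_lt_of_pos _ ha⟩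
    · rw [Finset.card_image_of_injOn]
      · have := card_lFinset hL.w_nonneg hL.w_lt hL.h_nonneg hL.h_lt
        rw [hL.area] at this
        simp only [Int.card_Ico]
        omega
      · intro p hp q hq hpq
        have hp := mem_lFinset.1 (Finset.mem_coe.1 hp)
        have hq := mem_lFinset.1 (Finset.mem_coe.1 hq)
        have := Int.ModEq.dvd hpq
        obtain ⟨h1, h2⟩ := hL.eq_of_dvd ha hg hp hq (by convert this using 1; ring)
        exact Prod.ext h1.symm h2.symm
  have hx : x % a ∈ Finset.Ico 0 a :=
    Finset.mem_Ico.2 ⟨Int.emod_nonneg _ ha.ne', Int.emod_lt_of_pos _ ha⟩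
  rw [← himg] at hx
  obtain ⟨p, hp, hpx⟩ := Finset.mem_image.1 hx
  obtain ⟨m, hm⟩ := Int.ModEq.dvd hpx
  refine ⟨p.1, p.2, m - cdiv p.1 k, mem_lFinset.1 hp, ?_⟩
  unfold weight
  linear_combination hm

/-! ### Existence of an L-shaped region -/

theorem exists_lShape_right {a d k c : ℤ} (ha : 0 < a) (hd : 0 < d) (hk : 0 < k) :
    ∃ W h : ℤ, 0 < W ∧ 0 ≤ h ∧ a ∣ d * W - c * h ∧ 0 ≤ (a + k * d) * W - k * c * h ∧
      ∀ W' h' : ℤ, 0 < W' → 0 ≤ h' → a ∣ d * W' - c * h' →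
        0 ≤ (a + k * d) * W' - k * c * h' → W < W' ∨ W = W' ∧ h ≤ h' := by
  let V : Set (ℕ ×ₗ ℕ) := {p | 0 < ((ofLex p).1 : ℤ) ∧
    a ∣ d * (ofLex p).1 - c * (ofLex p).2 ∧
    0 ≤ (a + k * d) * (ofLex p).1 - k * c * (ofLex p).2}
  have hne : V.Nonempty := by
    refine ⟨toLex (a.toNat, 0), ?_⟩
    have : ((a.toNat : ℕ) : ℤ) = a := Int.toNat_of_nonneg ha.le
    simp only [V, Set.mem_ofPred_eq, ofLex_toLex, this]
    refine ⟨ha, by simp, ?_⟩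
    push_cast
    have : 0 ≤ (a + k * d) * a := by positivity
    linarith
  obtain ⟨p, ⟨h1, h2, h3⟩, hmin⟩ := WellFounded.has_min (wellFounded_lt (α := ℕ ×ₗ ℕ)) V hne
  refine ⟨(ofLex p).1, (ofLex p).2, h1, by positivity, h2, h3, ?_⟩
  intro W' h' hW hh hdv hnn
  lift W' to ℕ using hW.le
  lift h' to ℕ using hh
  have := hmin (toLex (W', h')) ⟨by simpa using hW, by simpa using hdv, by simpa using hnn⟩
  rw [not_lt, Prod.Lex.le_iff] at this
  simpa using this

/-- The linear form is required to be strictly positive here but only non-negative for (W, -h). A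
lattice vector (y, -z) with y, z > 0 is then eligible for exactly one of the two minimizations, up
to sign. -/
theorem exists_lShape_up {a d k c : ℤ} (ha : 0 < a) (hc : 0 < c) (hk : 0 < k) :
    ∃ H w : ℤ, 0 < H ∧ 0 ≤ w ∧ a ∣ c * H - d * w ∧ 0 < k * c * H - (a + k * d) * w ∧
      ∀ H' w' : ℤ, 0 < H' → 0 ≤ w' → a ∣ c * H' - d * w' →
        0 < k * c * H' - (a + k * d) * w' → H < H' ∨ H = H' ∧ w ≤ w' := by
  let V : Set (ℕ ×ₗ ℕ) := {p | 0 < ((ofLex p).1 : ℤ) ∧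
    a ∣ c * (ofLex p).1 - d * (ofLex p).2 ∧
    0 < k * c * (ofLex p).1 - (a + k * d) * (ofLex p).2}
  have hne : V.Nonempty := by
    refine ⟨toLex (a.toNat, 0), ?_⟩
    have : ((a.toNat : ℕ) : ℤ) = a := Int.toNat_of_nonneg ha.le
    simp only [V, Set.mem_ofPred_eq, ofLex_toLex, this]
    refine ⟨ha, by simp, ?_⟩
    push_cast
    have : 0 < k * c * a := by positivity
    linarith
  obtain ⟨p, ⟨h1, h2, h3⟩, hmin⟩ := WellFounded.has_min (wellFounded_lt (α := ℕ ×ₗ ℕ)) V hne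
  refine ⟨(ofLex p).1, (ofLex p).2, h1, by positivity, h2, h3, ?_⟩
  intro W' h' hW hh hdv hnn
  lift W' to ℕ using hW.le
  lift h' to ℕ using hh
  have := hmin (toLex (W', h')) ⟨by simpa using hW, by simpa using hdv, by simpa using hnn⟩
  rw [not_lt, Prod.Lex.le_iff] at this
  simpa using this

/-- The two vectors are lexicographically minimal. Their determinant is positive and divisible by a;
minimality makes the points of the L incongruent mod the lattice, so by pigeonhole the determinant
is at most a. -/
theorem exists_lShape {a d k c : ℤ} (ha : 0 < a) (hd : 0 < d) (hc : 0 < c) (hk : 0 < k)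
    (hg : IsCoprime a d) : ∃ W w H h : ℤ, LShape a d k c W w H h := by
  obtain ⟨W, h, hW, hh, hv, hvn, hvmin⟩ := exists_lShape_right (c := c) ha hd hk
  obtain ⟨H, w, hH, hw, hu, hun, humin⟩ := exists_lShape_up (d := d) ha hc hk
  have hsum : a ∣ d * (W - w) + c * (H - h) := by
    exact (dvd_add hv hu).trans (dvd_of_eq (by ring))
  have hpos : 0 < (a + k * d) * (W - w) + k * c * (H - h) := by linarith
  have had : 0 < a + k * d := by positivity
  have hkc : 0 < k * c := by positivity
  have hwW : w < W := by
    by_contra hle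
    have hHh : 0 < H - h := by
      by_contra hneg
      have h1 : (a + k * d) * (W - w) ≤ 0 :=
        mul_nonpos_of_nonneg_of_nonpos had.le (by omega)
      have h2 : k * c * (H - h) ≤ 0 := mul_nonpos_of_nonneg_of_nonpos hkc.le (by omega)
      omega
    have := humin (H - h) (w - W) hHh (by omega) (by convert hsum using 1; ring)
      (by linarith)
    omega
  have hhH : h < H := by
    by_contra hle
    have := hvmin (W - w) (h - H) (by omega) (by omega) (by convert hsum using 1; ring)
      (by linarith)
    omega
  have har0 : 0 < W * H - w * h := by nlinarith
  have hdvd : a ∣ W * H - w * h := by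
    refine hg.dvd_of_dvd_mul_left ?_
    have := dvd_add (hv.mul_left H) (hu.mul_left h)
    convert this using 1
    ring
  -- Differences of points of the region lie in the lattice only if they vanish.
  have key : ∀ y z y' z' : ℤ, LRegion W w H h y z → LRegion W w H h y' z' → y < y' →
      a ∣ d * (y' - y) + c * (z' - z) → False := by
    intro y z y' z' hp hq hlt hdv
    obtain ⟨p0, p1, p2, p3, p4⟩ := hp
    obtain ⟨q0, q1, q2, q3, q4⟩ := hq
    by_cases hz : z' ≤ z
    · by_cases hl : 0 ≤ (a + k * d) * (y' - y) - k * c * (z - z')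
      · have := hvmin (y' - y) (z - z') (by omega) (by omega) (by convert hdv using 1; ring) hl
        omega
      · have hz' : 0 < z - z' := by
          by_contra h0
          obtain rfl : z = z' := by omega
          have : 0 < (a + k * d) * (y' - y) := mul_pos had (by omega)
          rw [sub_self, mul_zero] at hl
          omega
        have := humin (z - z') (y' - y) hz' (by omega)
          ((dvd_neg.2 hdv).trans (dvd_of_eq (by ring))) (by linarith)
        omega
    -- Both coordinates increase. Comparing the difference with (W, -h), and then with (-w, H),
    -- gives a shorter eligible vector unless the increments reach H - h and W - w; then (y', z')
    -- would lie in the removed corner.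
    · have hz1 : H - h ≤ z' - z := by
        by_contra hc1
        by_cases hl : 0 ≤ (a + k * d) * (W - (y' - y)) - k * c * (h + (z' - z))
        · have := hvmin (W - (y' - y)) (h + (z' - z)) (by omega) (by omega)
            ((dvd_sub hv hdv).trans (dvd_of_eq (by ring))) hl
          omega
        · have := humin (h + (z' - z)) (W - (y' - y)) (by omega) (by omega)
            ((dvd_sub hdv hv).trans (dvd_of_eq (by ring))) (by linarith)
          omega
      have hy1 : W - w ≤ y' - y := by
        by_contra hc1
        by_cases hl : 0 ≤ (a + k * d) * (w + (y' - y)) - k * c * (H - (z' - z))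
        · have := hvmin (w + (y' - y)) (H - (z' - z)) (by omega) (by omega)
            ((dvd_sub hdv hu).trans (dvd_of_eq (by ring))) hl
          omega
        · have := humin (H - (z' - z)) (w + (y' - y)) (by omega) (by omega)
            ((dvd_sub hu hdv).trans (dvd_of_eq (by ring))) (by linarith)
          omega
      omega
  have key' : ∀ z z' : ℤ, 0 ≤ z → z < z' → z' < H → a ∣ c * (z' - z) → False := by
    intro z z' h0 h1 h2 hdv
    have := humin (z' - z) 0 (by omega) le_rfl (by simpa using hdv)
      (by have : 0 < k * c * (z' - z) := mul_pos hkc (by omega)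
          linarith)
    omega
  have hle : ((lFinset W w H h).card : ℤ) ≤ a := by
    by_contra hgt
    obtain ⟨p, hp, q, hq, hne, heq⟩ := Finset.exists_ne_map_eq_of_card_lt_of_maps_to
      (s := lFinset W w H h) (t := Finset.Ico 0 a) (f := fun p => (d * p.1 + c * p.2) % a)
      (by rw [Int.card_Ico]; omega)
      (fun p _ => by
        simp only [Finset.coe_Ico, Set.mem_Ico]
        exact ⟨Int.emod_nonneg _ ha.ne', Int.emod_lt_of_pos _ ha⟩)
    have hp := mem_lFinset.1 hp
    have hq := mem_lFinset.1 hq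
    have h1 : a ∣ d * (q.1 - p.1) + c * (q.2 - p.2) := by
      convert Int.ModEq.dvd heq using 1; ring
    have h2 : a ∣ d * (p.1 - q.1) + c * (p.2 - q.2) := by
      convert Int.ModEq.dvd heq.symm using 1; ring
    rcases lt_trichotomy p.1 q.1 with hlt | he | hlt
    · exact key _ _ _ _ hp hq hlt h1
    · rcases lt_trichotomy p.2 q.2 with hlt | he' | hlt
      · exact key' _ _ hp.2.2.1 hlt hq.2.2.2.1 (by simpa [he] using h1)
      · exact hne (Prod.ext he he')
      · exact key' _ _ hq.2.2.1 hlt hp.2.2.2.1 (by simpa [he] using h2)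
    · exact key _ _ _ _ hq hp hlt h2
  rw [card_lFinset hw hwW hh hhH] at hle
  exact ⟨W, w, H, h, hw, hwW, hh, hhH, le_antisymm hle (Int.le_of_dvd har0 hdvd), hv, hu, hvn,
    hun.le⟩

/-! ### Pseudo-symmetry in terms of the region -/

/-- All points of the region but `(y₀, z₀)` are paired so that the weights in a pair sum to the
weight of `(Y, Z)`. -/
structure Paired (a d k c W w H h Y Z y₀ z₀ : ℤ) : Prop where
  top_mem : LRegion W w H h Y Z
  mid_mem : LRegion W w H h y₀ z₀
  mid : 2 * weight a d k c y₀ z₀ = weight a d k c Y Z + a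
  le_mid : a ≤ weight a d k c y₀ z₀
  pair : ∀ y z, LRegion W w H h y z → ¬(y = y₀ ∧ z = z₀) → ∃ y' z', LRegion W w H h y' z' ∧
    weight a d k c y z + weight a d k c y' z' = weight a d k c Y Z

theorem LShape.isPseudoSymmetric {a d k c W w H h Y Z y₀ z₀ : ℤ} (hL : LShape a d k c W w H h)
    (ha : 0 < a) (hd : 0 < d) (hc : 0 < c) (hk : 0 < k) (hg : IsCoprime a d)
    (hP : Paired a d k c W w H h Y Z y₀ z₀) : IsPseudoSymmetric (AASemigroup a d k c) := by
  obtain ⟨htop, hmid, hm, hle, hpair⟩ := hP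
  set S := AASemigroup a d k c
  have hmem := fun y z m hp => hL.weight_sub_mem_iff (y := y) (z := z) (m := m) ha hk hg hp
  have hgS : weight a d k c Y Z - a ∉ S := fun h => by
    have := (hmem Y Z (-1) htop).1 (by convert h using 1; ring)
    omega
  have hg2 : (weight a d k c Y Z - a) / 2 = weight a d k c y₀ z₀ - a := by omega
  have hcov : ∀ x, (x ∈ S ∨ weight a d k c Y Z - a - x ∈ S) ↔
      x ≠ (weight a d k c Y Z - a) / 2 := by
    intro x
    rw [hg2]
    constructor
    · rintro hx rfl
      have : weight a d k c y₀ z₀ - a ∈ S := by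
        rcases hx with hx | hx
        · exact hx
        · convert hx using 1
          linarith
      have := (hmem y₀ z₀ (-1) hmid).1 (by convert this using 1; ring)
      omega
    · intro hx
      obtain ⟨y, z, m, hp, rfl⟩ := hL.exists_eq (k := k) (c := c) ha hg x
      by_cases hm0 : 0 ≤ m
      · exact Or.inl ((hmem y z m hp).2 hm0)
      right
      by_cases hyz : y = y₀ ∧ z = z₀
      · obtain ⟨rfl, rfl⟩ := hyz
        have hm1 : m ≠ -1 := by
          rintro rfl
          exact hx (by ring)
        have := (hmem y z (-2 - m) hp).2 (by omega)
        convert this using 1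
        linear_combination -hm
      · obtain ⟨y', z', hq, he⟩ := hpair y z hp hyz
        have := (hmem y' z' (-1 - m) hq).2 (by omega)
        convert this using 1
        linear_combination -he
  refine ⟨weight a d k c Y Z - a, ⟨hgS, ?_⟩, ⟨weight a d k c y₀ z₀ - a, by linarith⟩,
    union_sub_eq_univ_diff_iff.2 hcov⟩
  intro x hx
  by_contra hlt
  rcases (hcov x).2 (by omega) with h | h
  · exact hx h
  · have := AASemigroup.nonneg_of_mem ha hd hc hk h
    omega

theorem IsPseudoSymmetric.exists_paired {a d k c W w H h : ℤ} (hL : LShape a d k c W w H h)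
    (ha : 0 < a) (hd : 0 < d) (hc : 0 < c) (hk : 0 < k) (hg : IsCoprime a d)
    (hS : IsPseudoSymmetric (AASemigroup a d k c)) :
    ∃ Y Z y₀ z₀, Paired a d k c W w H h Y Z y₀ z₀ := by
  obtain ⟨g, ⟨hgS, hmax⟩, ⟨e, hge⟩, hcov⟩ := hS
  rw [union_sub_eq_univ_diff_iff] at hcov
  have hg2 : g / 2 = e := by omega
  rw [hg2] at hcov
  set S := AASemigroup a d k c
  have hgS : g ∉ S := hgS
  have hmax : ∀ x, g < x → x ∈ S := fun x hx => by
    by_contra h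
    exact absurd (hmax h) (by omega)
  have hmem := fun y z m hp => hL.weight_sub_mem_iff (y := y) (z := z) (m := m) ha hk hg hp
  have haS : a ∈ S := AddSubmonoid.subset_closure (Or.inl ⟨0, le_rfl, hk.le, by ring⟩)
  have heS : e ∉ S := fun h => (hcov e).1 (Or.inl h) rfl
  -- As g is even this gives g/2 ≥ 0, which is the bound `le_mid`.
  have hg0 : -1 ≤ g := by
    by_contra h
    have := AASemigroup.nonneg_of_mem ha hd hc hk (hmax (-1) (by omega))
    omega
  obtain ⟨Y, Z, m, htop, hm⟩ := hL.exists_eq (k := k) (c := c) ha hg g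
  obtain rfl : m = -1 := by
    have h1 : ¬ 0 ≤ m := fun h => hgS (hm ▸ (hmem Y Z m htop).2 h)
    have h2 := (hmem Y Z (m + 1) htop).1 (by
      have := hmax (g + a) (by omega)
      convert this using 1
      linear_combination -hm)
    omega
  obtain ⟨y₀, z₀, m, hmid, hm'⟩ := hL.exists_eq (k := k) (c := c) ha hg e
  obtain rfl : m = -1 := by
    have h1 : ¬ 0 ≤ m := fun h => heS (hm' ▸ (hmem y₀ z₀ m hmid).2 h)
    have h2 : e + a ∈ S := by
      rcases (hcov (e + a)).2 (by omega) with h | h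
      · exact h
      · exfalso
        apply heS
        have := add_mem h haS
        convert this using 1
        linear_combination -hge
    have h3 := (hmem y₀ z₀ (m + 1) hmid).1 (by
      convert h2 using 1
      linear_combination -hm')
    omega
  refine ⟨Y, Z, y₀, z₀, htop, hmid, by linarith, by omega, ?_⟩
  intro y z hp hne
  have hpS : weight a d k c y z - a ∉ S := fun h => by
    have := (hmem y z (-1) hp).1 (by convert h using 1; ring)
    omega
  have hpe : weight a d k c y z - a ≠ e := by
    intro he
    apply hne
    refine hL.eq_of_dvd ha hg hmid hp ⟨cdiv y₀ k - cdiv y k, ?_⟩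
    unfold weight at he hm'
    linear_combination he + hm'
  have hq := ((hcov _).2 hpe).resolve_left hpS
  obtain ⟨y', z', m, hq', hm''⟩ :=
    hL.exists_eq (k := k) (c := c) ha hg (weight a d k c Y Z - weight a d k c y z)
  refine ⟨y', z', hq', ?_⟩
  have h1 : 0 ≤ m := (hmem y' z' m hq').1 (by
    rw [← hm'']
    convert hq using 1
    linear_combination -hm)
  -- With a spare copy of a, the two weights would exhibit g itself as an element of S.
  have h2 : ¬ 1 ≤ m := by
    intro h2
    apply hgS
    have := add_mem (weight_mem (a := a) (d := d) (c := c) hk hp.1 hp.2.2.1)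
      ((hmem y' z' (m - 1) hq').2 (by omega))
    convert this using 1
    linear_combination hm + hm''
  obtain rfl : m = 0 := by omega
  linarith

/-! ### The shape of a paired region -/

theorem weight_nonneg {a d k c y z : ℤ} (ha : 0 < a) (hd : 0 < d) (hc : 0 < c) (hk : 0 < k)
    (hy : 0 ≤ y) (hz : 0 ≤ z) : 0 ≤ weight a d k c y z :=
  AASemigroup.nonneg_of_mem ha hd hc hk (weight_mem hk hy hz)

theorem weight_lt_right {a d k c y z : ℤ} (ha : 0 < a) (hd : 0 < d) (hk : 0 < k) :
    weight a d k c y z < weight a d k c (y + 1) z := by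
  have := mul_le_mul_of_nonneg_left (cdiv_mono hk (show y ≤ y + 1 by omega)) ha.le
  unfold weight
  linarith

theorem weight_lt_up {a d k c y z : ℤ} (hc : 0 < c) :
    weight a d k c y z < weight a d k c y (z + 1) := by
  unfold weight
  linarith

theorem Paired.weight_le_top {a d k c W w H h Y Z y₀ z₀ y z : ℤ}
    (hP : Paired a d k c W w H h Y Z y₀ z₀) (ha : 0 < a) (hd : 0 < d) (hc : 0 < c) (hk : 0 < k)
    (hp : LRegion W w H h y z) : weight a d k c y z ≤ weight a d k c Y Z := by
  by_cases hyz : y = y₀ ∧ z = z₀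
  · obtain ⟨rfl, rfl⟩ := hyz
    linarith [hP.mid, hP.le_mid]
  · obtain ⟨y', z', hq, he⟩ := hP.pair y z hp hyz
    linarith [weight_nonneg ha hd hc hk hq.1 hq.2.2.1]

theorem Paired.corner {a d k c W w H h Y Z y₀ z₀ : ℤ}
    (hP : Paired a d k c W w H h Y Z y₀ z₀) (hL : LShape a d k c W w H h)
    (ha : 0 < a) (hd : 0 < d) (hc : 0 < c) (hk : 0 < k) :
    (Y = W - 1 ∧ Z = H - h - 1 ∧ (1 ≤ w ∨ h = 0)) ∨
      (Y = W - w - 1 ∧ Z = H - 1 ∧ (1 ≤ h ∨ w = 0)) := by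
  have h1 : ¬ LRegion W w H h (Y + 1) Z := fun h1 => by
    linarith [hP.weight_le_top ha hd hc hk h1,
      weight_lt_right (a := a) (d := d) (k := k) (c := c) (y := Y) (z := Z) ha hd hk]
  have h2 : ¬ LRegion W w H h Y (Z + 1) := fun h1 => by
    linarith [hP.weight_le_top ha hd hc hk h1,
      weight_lt_up (a := a) (d := d) (k := k) (c := c) (y := Y) (z := Z) hc]
  have h3 := hP.top_mem
  obtain ⟨hw0, hw1, hh0, hh1, -, -, -, -, -⟩ := hL
  unfold LRegion at h1 h2 h3
  omega

/-- The partner of a point is determined by its class, so any point of the region in the class of (Y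
- y, Z - z) is the partner. The exceptional point is its own partner in this sense, with sum too
large by a. -/
theorem Paired.add_eq {a d k c W w H h Y Z y₀ z₀ y z y' z' : ℤ}
    (hP : Paired a d k c W w H h Y Z y₀ z₀) (hL : LShape a d k c W w H h)
    (ha : 0 < a) (hg : IsCoprime a d) (hp : LRegion W w H h y z) (hq : LRegion W w H h y' z')
    (hdvd : a ∣ d * (y + y' - Y) + c * (z + z' - Z)) :
    (¬(y = y₀ ∧ z = z₀) →
      weight a d k c y z + weight a d k c y' z' = weight a d k c Y Z) ∧
    (y = y₀ ∧ z = z₀ → y' = y₀ ∧ z' = z₀) := by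
  obtain ⟨e, he⟩ := hdvd
  constructor
  · intro hne
    obtain ⟨y₁, z₁, hq₁, h₁⟩ := hP.pair y z hp hne
    obtain ⟨rfl, rfl⟩ := hL.eq_of_dvd ha hg hq₁ hq ⟨e - cdiv Y k + cdiv y k + cdiv y₁ k, by
      unfold weight at h₁
      linear_combination he - h₁⟩
    exact h₁
  · rintro ⟨rfl, rfl⟩
    have hm := hP.mid
    refine hL.eq_of_dvd ha hg hp hq ⟨e - cdiv Y k + 2 * cdiv y k - 1, ?_⟩
    unfold weight at hm
    linear_combination he - hm

theorem LRegion.of_le {W w H h Y Z y z : ℤ} (ht : LRegion W w H h Y Z) (hy0 : 0 ≤ y) (hy : y ≤ Y)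
    (hz0 : 0 ≤ z) (hz : z ≤ Z) : LRegion W w H h y z := by
  unfold LRegion at *
  omega

theorem Paired.cdiv_add_eq {a d k c W w H h Y Z y₀ z₀ y z : ℤ}
    (hP : Paired a d k c W w H h Y Z y₀ z₀) (hL : LShape a d k c W w H h)
    (ha : 0 < a) (hg : IsCoprime a d) (hy0 : 0 ≤ y) (hy : y ≤ Y)
    (hz0 : 0 ≤ z) (hz : z ≤ Z) :
    (¬(y = y₀ ∧ z = z₀) → cdiv y k + cdiv (Y - y) k = cdiv Y k) ∧
    (y = y₀ ∧ z = z₀ → 2 * y₀ = Y ∧ 2 * z₀ = Z) := by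
  have hp := hP.top_mem.of_le hy0 hy hz0 hz
  have hq := hP.top_mem.of_le (y := Y - y) (z := Z - z) (by omega) (by omega) (by omega) (by omega)
  obtain ⟨h1, h2⟩ := hP.add_eq hL ha hg hp hq ⟨0, by ring⟩
  refine ⟨fun hne => ?_, fun he => ?_⟩
  · have := h1 hne
    unfold weight at this
    refine mul_left_cancel₀ ha.ne' ?_
    linear_combination this
  · have := h2 he
    omega

/-- Either the region is so small that the exceptional point lies below the top one, or the
width below the top point is as for a symmetric semigroup. -/
theorem Paired.below_top {a d k c W w H h Y Z y₀ z₀ : ℤ}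
    (hP : Paired a d k c W w H h Y Z y₀ z₀) (hL : LShape a d k c W w H h)
    (ha : 0 < a) (hk : 2 ≤ k) (hg : IsCoprime a d) :
    (Y = 2 ∧ Z = 0 ∧ y₀ = 1 ∧ z₀ = 0) ∨ ((Y = 0 ∨ k ∣ Y - 1) ∧ ¬(y₀ ≤ Y ∧ z₀ ≤ Z)) := by
  have hk0 : 0 < k := by omega
  have hY0 := hP.top_mem.1
  have hZ0 := hP.top_mem.2.2.1
  have hy0 := hP.mid_mem.1
  have hz0 := hP.mid_mem.2.2.1
  by_cases hle : y₀ ≤ Y ∧ z₀ ≤ Z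
  · left
    obtain ⟨rfl, rfl⟩ := (hP.cdiv_add_eq hL ha hg hy0 hle.1 hz0 hle.2).2 ⟨rfl, rfl⟩
    -- The excess a of the exceptional pair appears as a defect of one between ceilings; each
    -- contradiction below derives the same identity without the defect.
    have hm : 2 * cdiv y₀ k = cdiv (2 * y₀) k + 1 := by
      have := hP.mid
      unfold weight at this
      refine mul_left_cancel₀ ha.ne' ?_
      linear_combination this
    have hz : z₀ = 0 := by
      by_contra hz
      have := (hP.cdiv_add_eq (z := 0) hL ha hg hy0 hle.1 le_rfl (by omega)).1 (by omega)
      rw [show 2 * y₀ - y₀ = y₀ by ring] at this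
      omega
    have hy : y₀ ≠ 0 := by
      rintro rfl
      simp at hm
    have hy1 : y₀ = 1 := by
      by_contra hy1
      have h1 := (hP.cdiv_add_eq (y := 1) (z := 0) hL ha hg (by omega) (by omega) le_rfl
        (by omega)).1 (by omega)
      rw [cdiv_one hk0] at h1
      have h2 := cdiv_add_cdiv_sub (y := y₀) hk0
        (dvd_of_cdiv_sub_one (y := 2 * y₀) hk0 (by omega))
      rw [show 2 * y₀ - y₀ = y₀ by ring] at h2
      omega
    omega
  · right
    refine ⟨?_, hle⟩
    by_cases hY : Y = 0
    · exact Or.inl hY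
    · right
      have h1 := (hP.cdiv_add_eq (y := 1) (z := 0) hL ha hg (by omega) (by omega) le_rfl
        hZ0).1 (by rintro ⟨rfl, rfl⟩; omega)
      rw [cdiv_one hk0] at h1
      exact dvd_of_cdiv_sub_one hk0 (by omega)

/-- If the top point is the right corner, the rest of the region is a row of length one or
three. -/
theorem Paired.right_corner {a d k c W w H h y₀ z₀ : ℤ}
    (hP : Paired a d k c W w H h (W - 1) (H - h - 1) y₀ z₀) (hL : LShape a d k c W w H h)
    (ha : 0 < a) (hk : 2 ≤ k) (hg : IsCoprime a d)
    (hle : ¬(y₀ ≤ W - 1 ∧ z₀ ≤ H - h - 1)) :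
    h = 1 ∧ z₀ = H - 1 ∧ (w = W - 1 ∧ y₀ = 0 ∨ w = W - 3 ∧ y₀ = 1) := by
  have hk0 : 0 < k := by omega
  obtain ⟨m0, m1, m2, m3, m4⟩ := hP.mid_mem
  have hw1 := hL.w_lt
  have hw0 := hL.w_nonneg
  have hh1 := hL.h_lt
  have hmid := hP.mid
  -- The block above the top point is reflected in itself: the sum of the two points is the top plus
  -- the lattice vector (-w, H).
  have refl : ∀ y z, 0 ≤ y → y < W - w → H - h ≤ z → z < H →
      (¬(y = y₀ ∧ z = z₀) → weight a d k c y z +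
        weight a d k c (W - w - 1 - y) (2 * H - h - 1 - z) =
          weight a d k c (W - 1) (H - h - 1)) ∧
      (y = y₀ ∧ z = z₀ → W - w - 1 - y = y₀ ∧ 2 * H - h - 1 - z = z₀) := by
    intro y z h1 h2 h3 h4
    refine hP.add_eq hL ha hg (by unfold LRegion; omega) (by unfold LRegion; omega) ?_
    exact hL.dvd_up.trans (dvd_of_eq (by ring))
  obtain ⟨hy, hz⟩ := (refl y₀ z₀ m0 (by omega) (by omega) m3).2 ⟨rfl, rfl⟩
  -- In a higher block, the column through the centre contains an ordinary pair with the same sum as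
  -- twice the centre, which has excess a.
  have hh : h = 1 := by
    by_contra hh
    have h1 := (refl y₀ (H - 1) m0 (by omega) (by omega) (by omega)).1 (by omega)
    rw [hy] at h1
    unfold weight at h1 hmid
    have h2 : 2 * (a * cdiv y₀ k + d * y₀ + c * z₀) = a * cdiv y₀ k + d * y₀ + c * (H - 1) +
        (a * cdiv y₀ k + d * y₀ + c * (2 * H - h - 1 - (H - 1))) := by
      linear_combination -c * hz
    omega
  subst hh
  have hz : z₀ = H - 1 := by omega
  subst hz
  -- In a longer row the pairs starting at 0 and 1 give k ∣ 2y₀ - 1, and then the ceilings at the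
  -- centre add up without defect.
  have hy2 : y₀ < 2 := by
    by_contra hy2
    have h0 := (refl 0 (H - 1) le_rfl (by omega) (by omega) (by omega)).1 (by omega)
    have h1 := (refl 1 (H - 1) (by omega) (by omega) (by omega) (by omega)).1 (by omega)
    have hA : W - w - 1 = 2 * y₀ := by omega
    rw [hA] at h0 h1
    unfold weight at h0 h1 hmid
    rw [cdiv_one hk0] at h1
    rw [cdiv_zero_left, sub_zero] at h0
    have hc1 : cdiv (2 * y₀) k = 1 + cdiv (2 * y₀ - 1) k := by
      refine mul_left_cancel₀ ha.ne' ?_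
      linear_combination h0 - h1
    have h2 := cdiv_add_cdiv_sub (y := y₀) hk0
        (dvd_of_cdiv_sub_one (y := 2 * y₀) hk0 (by omega))
    rw [show 2 * y₀ - y₀ = y₀ by ring] at h2
    have : a = 0 := by linear_combination h0 - hmid + a * h2
    omega
  omega

/-- If the top point is the upper corner, the rest of the region is a row of length one or
`2 k - 1`. -/
theorem Paired.upper_corner {a d k c W w H h y₀ z₀ : ℤ}
    (hP : Paired a d k c W w H h (W - w - 1) (H - 1) y₀ z₀) (hL : LShape a d k c W w H h)
    (ha : 0 < a) (hk : 2 ≤ k) (hg : IsCoprime a d)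
    (hY : W - w - 1 = 0 ∨ k ∣ W - w - 1 - 1)
    (hle : ¬(y₀ ≤ W - w - 1 ∧ z₀ ≤ H - 1)) :
    h = H - 1 ∧ z₀ = 0 ∧ (w = 1 ∧ y₀ = W - 1 ∨
      w = 2 * k - 1 ∧ y₀ = W - k ∧ k ∣ W - w - 2) := by
  have hk0 : 0 < k := by omega
  obtain ⟨m0, m1, m2, m3, m4⟩ := hP.mid_mem
  have hw1 := hL.w_lt
  have hw0 := hL.w_nonneg
  have hh0 := hL.h_nonneg
  have hh1 := hL.h_lt
  have hmid := hP.mid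
  -- Here the block to the right of the top is reflected, with shift (W, -h).
  have refl : ∀ y z, W - w ≤ y → y < W → 0 ≤ z → z < H - h →
      (¬(y = y₀ ∧ z = z₀) → weight a d k c y z +
        weight a d k c (2 * W - w - 1 - y) (H - h - 1 - z) =
          weight a d k c (W - w - 1) (H - 1)) ∧
      (y = y₀ ∧ z = z₀ → 2 * W - w - 1 - y = y₀ ∧ H - h - 1 - z = z₀) := by
    intro y z h1 h2 h3 h4
    refine hP.add_eq hL ha hg (by unfold LRegion; omega) (by unfold LRegion; omega) ?_
    exact hL.dvd_right.trans (dvd_of_eq (by ring))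
  obtain ⟨hy, hz⟩ := (refl y₀ z₀ (by omega) (by omega) (by omega) (by omega)).2 ⟨rfl, rfl⟩
  have hh : h = H - 1 := by
    by_contra hh
    have h1 := (refl y₀ 0 (by omega) (by omega) (by omega) (by omega)).1 (by omega)
    rw [hy] at h1
    unfold weight at h1 hmid
    have h2 : 2 * (a * cdiv y₀ k + d * y₀ + c * z₀) = a * cdiv y₀ k + d * y₀ + c * 0 +
        (a * cdiv y₀ k + d * y₀ + c * (H - h - 1 - 0)) := by
      linear_combination -c * hz
    omega
  have hz : z₀ = 0 := by omega
  refine ⟨hh, hz, ?_⟩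
  subst hz
  by_cases hw : w = 1
  · left
    omega
  right
  have hrefl : ∀ j, 1 ≤ j → W - w ≤ y₀ - j →
      cdiv (y₀ - j) k + cdiv (y₀ + j) k + 1 = 2 * cdiv y₀ k := by
    intro j hj1 hj2
    have h1 := (refl (y₀ - j) 0 hj2 (by omega) le_rfl (by omega)).1 (by omega)
    rw [show 2 * W - w - 1 - (y₀ - j) = y₀ + j by omega] at h1
    rw [show H - h - 1 - 0 = 0 by omega] at h1
    unfold weight at h1 hmid
    refine mul_left_cancel₀ ha.ne' ?_
    linear_combination h1 - hmid
  have hdvd : k ∣ y₀ - 1 := by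
    have := hrefl 1 le_rfl (by omega)
    have h2 := cdiv_mono hk0 (show y₀ ≤ y₀ + 1 by omega)
    exact dvd_of_cdiv_sub_one hk0 (by omega)
  -- At distance k from the centre the two ceilings add up to twice the central one, so the row must
  -- end earlier. Together with k ∣ y₀ - 1 and k ∣ W - w - 2 this fixes the half-length.
  have hlt : y₀ - k < W - w := by
    by_contra hlt
    have := hrefl k (by omega) (by omega)
    have h1 := cdiv_add_mul (y := y₀) (i := 1) hk0
    have h2 := cdiv_add_mul (y := y₀) (i := -1) hk0
    rw [one_mul] at h1
    rw [neg_one_mul, ← sub_eq_add_neg] at h2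
    omega
  rcases hY with hY | hY
  · exfalso
    have := Int.le_of_dvd (by omega) hdvd
    omega
  · have h1 : k ∣ y₀ - (W - w) + 1 := by
      have := dvd_sub hdvd hY
      exact this.trans (dvd_of_eq (by ring))
    have := Int.le_of_dvd (by omega) h1
    refine ⟨by omega, by omega, hY.trans (dvd_of_eq (by ring))⟩

/-! ### Parameters of the pseudo-symmetric semigroups -/

/-- The families of parameters of pseudo-symmetric semigroups, in terms of integers. -/
def PseudoSymmetricParams (a d k c : ℤ) : Prop :=
  AASemigroup a d k c = AddSubmonoid.closure {3, 3 + d, 3 + 2 * d} ∨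
  (a * (c - 1) = 2 * (c + d) ∧ Odd c) ∨
  (∃ l m : ℤ, 0 ≤ l ∧ 1 ≤ m ∧ a = (2 + l * k) * (m + 1) + 1 ∧ a ∣ c + (2 + l * k) * d ∧
    l * (a + k * d) = c * m - 3 * d) ∨
  (∃ l v : ℤ, 2 ≤ l ∧ 0 ≤ v ∧ a = (v + 1) * (2 + (l - 2) * k) + (l * k + 1) ∧
    a ∣ c + (2 + (l - 2) * k) * d ∧ l * (a + k * d) = c * (v + 1) - d) ∨
  (∃ q R s : ℤ, 2 ≤ q ∧ R ≡ 2 [ZMOD k] ∧ s ≡ 2 [ZMOD k] ∧ a = (q - 1) * s + 1 ∧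
    a + k * d = q * R + 2 * k - 1 ∧ k * c = (R + 2 * k - 1) * (s - 1) + 2 * k - 1) ∨
  (∃ q R s : ℤ, 2 ≤ q ∧ R ≡ 2 [ZMOD k] ∧ s ≡ 2 [ZMOD k] ∧ s ≠ 2 ∧ a = (q - 1) * s + 3 ∧
    a + k * d = q * R + 1 ∧ k * c = (R + 1) * (s - 3) + 3)

theorem mul_mem_closure_triple {d n r : ℤ} (hr : 0 ≤ r) (hr2 : r ≤ 2) (hn : 0 ≤ n)
    (h : r = 0 ∨ 1 ≤ n) : 3 * n + r * d ∈ AddSubmonoid.closure ({3, 3 + d, 3 + 2 * d} : Set ℤ) := by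
  have h3 : ∀ n : ℤ, 0 ≤ n → 3 * n ∈ AddSubmonoid.closure ({3, 3 + d, 3 + 2 * d} : Set ℤ) := by
    intro n hn
    lift n to ℕ using hn
    have := nsmul_mem (AddSubmonoid.subset_closure (s := ({3, 3 + d, 3 + 2 * d} : Set ℤ))
      (show (3 : ℤ) ∈ _ by simp)) n
    rwa [nsmul_eq_mul, mul_comm (n : ℤ)] at this
  by_cases hr0 : r = 0
  · subst hr0
    simpa using h3 n hn
  · have hgen : 3 + r * d ∈ AddSubmonoid.closure ({3, 3 + d, 3 + 2 * d} : Set ℤ) := by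
      apply AddSubmonoid.subset_closure
      have : r = 1 ∨ r = 2 := by omega
      rcases this with rfl | rfl <;> simp
    convert add_mem (h3 (n - 1) (by omega)) hgen using 1
    ring

theorem AASemigroup.eq_closure_triple {d k c n r : ℤ} (hd : 0 < d) (hk : 2 ≤ k)
    (hr : 0 ≤ r) (hr2 : r ≤ 2) (hn : 0 ≤ n) (h : r = 0 ∨ 1 ≤ n) (hc : c = 3 * n + r * d) :
    AASemigroup 3 d k c = AddSubmonoid.closure {3, 3 + d, 3 + 2 * d} := by
  apply le_antisymm
  · refine AddSubmonoid.closure_le.2 ?_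
    rintro x (⟨i, hi0, -, rfl⟩ | rfl)
    · have hq : 0 ≤ i / 3 := by omega
      have := mul_mem_closure_triple (d := d) (n := 1 + i / 3 * d) (r := i % 3) (by omega) (by omega)
        (by positivity) (Or.inr (by nlinarith))
      rw [show 3 + i * d = 3 * (1 + i / 3 * d) + i % 3 * d by
        linear_combination (-d) * Int.emod_add_mul_ediv i 3]
      exact this
    · rw [hc]
      exact mul_mem_closure_triple hr hr2 hn h
  · refine AddSubmonoid.closure_le.2 ?_
    rintro x (rfl | rfl | rfl) <;> apply AddSubmonoid.subset_closure <;> left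
    · exact ⟨0, by omega, by omega, by ring⟩
    · exact ⟨1, by omega, by omega, by ring⟩
    · exact ⟨2, by omega, by omega, by ring⟩

theorem pseudoSymmetricParams_of_top_eq_two {a d k c W w H h : ℤ}
    (hP : Paired a d k c W w H h 2 0 1 0) (hL : LShape a d k c W w H h)
    (ha : 0 < a) (hd : 0 < d) (hc : 0 < c) (hk : 2 ≤ k) (hg : IsCoprime a d) :
    PseudoSymmetricParams a d k c := by
  have hk0 : 0 < k := by omega
  have hcor := hP.corner hL ha hd hc hk0
  obtain ⟨hw0, hw1, hh0, hh1, har, hdr, hdu, hrn, hun⟩ := id hL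
  by_cases hh : h = 0
  · -- the region is a row of length three
    subst hh
    obtain ⟨rfl, rfl⟩ : W = 3 ∧ H = 1 := by omega
    obtain rfl : a = 3 := by omega
    left
    obtain ⟨n, hn⟩ := hdu
    have hn0 : 0 ≤ n := by
      by_contra h0
      have h1 : k * n ≤ 2 * (-1) := by nlinarith
      have : k * (c * 1 - d * w) = k * (3 * n) := by rw [hn]
      nlinarith
    refine AASemigroup.eq_closure_triple (n := n) (r := w) hd hk hw0 (by omega) hn0 ?_
      (by linarith)
    by_contra hcon
    obtain rfl : n = 0 := by omega
    have : c = d * w := by linarith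
    subst this
    have : 0 < w := by omega
    nlinarith
  obtain ⟨rfl, hH⟩ : W = 3 ∧ H = h + 1 := by omega
  subst hH
  have hw : w = 1 ∨ w = 2 := by omega
  rcases hw with rfl | rfl
  · exfalso
    -- This pair would give c (h + 1) = d, against `up_nonneg`.
    have h1 := (hP.add_eq (y := 0) (z := h) (y' := 1) (z' := 1) hL ha hg
      (by unfold LRegion; omega) (by unfold LRegion; omega)
      (hdu.trans (dvd_of_eq (by ring)))).1 (by omega)
    unfold weight at h1
    rw [cdiv_zero_left, cdiv_one hk0, cdiv_two hk] at h1
    have h2 : c * (h + 1) = d := by linarith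
    have h3 : k * c * (h + 1) = k * d := by rw [mul_assoc, h2]
    rw [h3] at hun
    linarith
  · right; left
    have h1 := (hP.add_eq (y := 0) (z := h) (y' := 0) (z' := 1) hL ha hg
      (by unfold LRegion; omega) (by unfold LRegion; omega)
      (hdu.trans (dvd_of_eq (by ring)))).1 (by omega)
    unfold weight at h1
    rw [cdiv_zero_left, cdiv_two hk] at h1
    have hah : a = h + 3 := by linarith
    have h2 : a * (c - 1) = 2 * (c + d) := by rw [hah] at h1 ⊢; linarith
    refine ⟨h2, ?_⟩
    -- The sum of the two lattice vectors is (1, 1); the quotient n satisfies c - 1 = 2 n, whence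
    -- the parity.
    have h3 : a ∣ c + d := (dvd_add hdr hdu).trans (dvd_of_eq (by ring))
    obtain ⟨n, hn⟩ := h3
    refine ⟨n, ?_⟩
    have : c - 1 = 2 * n := by
      refine mul_left_cancel₀ ha.ne' ?_
      linear_combination h2 + 2 * hn
    omega

theorem pseudoSymmetricParams_of_right_corner {a d k c W w H h y₀ z₀ : ℤ}
    (hP : Paired a d k c W w H h (W - 1) (H - h - 1) y₀ z₀) (hL : LShape a d k c W w H h)
    (ha : 0 < a) (hk : 2 ≤ k) (hg : IsCoprime a d) (hcor : 1 ≤ w ∨ h = 0)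
    (hY : W - 1 = 0 ∨ k ∣ W - 1 - 1)
    (hle : ¬(y₀ ≤ W - 1 ∧ z₀ ≤ H - h - 1)) :
    PseudoSymmetricParams a d k c := by
  have hk0 : 0 < k := by omega
  obtain ⟨rfl, rfl, hcase⟩ := hP.right_corner hL ha hk hg hle
  obtain ⟨hw0, hw1, hh0, hh1, har, ⟨e, hdr⟩, hdu, hrn, hun⟩ := id hL
  obtain ⟨l, hl⟩ : k ∣ W - 1 - 1 := hY.resolve_left (by omega)
  obtain rfl : W = 2 + l * k := by linarith
  have hmid := hP.mid
  unfold weight at hmid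
  rw [show 2 + l * k - 1 = 1 + l * k by ring, cdiv_add_mul hk0, cdiv_one hk0] at hmid
  have hH : H ≠ 0 := by omega
  -- The parameters are q₁ = H, s₀ = W and R₀ = ((a + k d) W - k c) / a.
  have hR : 2 + l * k + k * e ≡ 2 [ZMOD k] := by
    refine (Int.modEq_iff_dvd.2 ⟨-(l + e), by ring⟩)
  have hs : 2 + l * k ≡ 2 [ZMOD k] := Int.modEq_iff_dvd.2 ⟨-l, by ring⟩
  rcases hcase with ⟨rfl, rfl⟩ | ⟨rfl, rfl⟩
  · right; right; right; right; left
    rw [cdiv_zero_left] at hmid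
    have h1 : a + k * d = H * (2 + l * k + k * e) + 2 * k - 1 := by
      refine mul_left_cancel₀ ha.ne' ?_
      linear_combination k * H * hdr + k * hmid - (a + k * d) * har
    refine ⟨H, 2 + l * k + k * e, 2 + l * k, by omega, hR, hs, by linear_combination -har, h1, ?_⟩
    refine mul_left_cancel₀ hH ?_
    linear_combination k * hmid + (1 + l * k) * h1 - (2 * k - 1) * har
  · right; right; right; right; right
    rw [cdiv_one hk0] at hmid
    have h1 : a + k * d = H * (2 + l * k + k * e) + 1 := by
      refine mul_left_cancel₀ ha.ne' ?_
      linear_combination k * H * hdr + k * hmid - (a + k * d) * har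
    refine ⟨H, 2 + l * k + k * e, 2 + l * k, by omega, hR, hs, by omega,
      by linear_combination -har, h1, ?_⟩
    refine mul_left_cancel₀ hH ?_
    linear_combination k * hmid + (l * k - 1) * h1 - har

theorem pseudoSymmetricParams_of_upper_corner {a d k c W w H h y₀ z₀ : ℤ}
    (hP : Paired a d k c W w H h (W - w - 1) (H - 1) y₀ z₀) (hL : LShape a d k c W w H h)
    (ha : 0 < a) (hk : 2 ≤ k) (hg : IsCoprime a d) (hcor : 1 ≤ h ∨ w = 0)
    (hY : W - w - 1 = 0 ∨ k ∣ W - w - 1 - 1)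
    (hle : ¬(y₀ ≤ W - w - 1 ∧ z₀ ≤ H - 1)) :
    PseudoSymmetricParams a d k c := by
  have hk0 : 0 < k := by omega
  obtain ⟨hhH, rfl, hcase⟩ := hP.upper_corner hL ha hk hg hY hle
  obtain rfl : H = h + 1 := by omega
  obtain ⟨hw0, hw1, hh0, hh1, har, hdr, hdu, hrn, hun⟩ := id hL
  have hmid := hP.mid
  unfold weight at hmid
  have hsum : a ∣ c + (W - w) * d := (dvd_add hdr hdu).trans (dvd_of_eq (by ring))
  rcases hcase with ⟨rfl, rfl⟩ | ⟨rfl, rfl, l, hl⟩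
  -- Then the top lies in column 0 and family (b) arises once more.
  · by_cases hW : W = 2
    · subst hW
      right; left
      norm_num [cdiv_one hk0] at hmid
      have hah : a = h + 2 := by linarith
      have h2 : a * (c - 1) = 2 * (c + d) := by rw [hah] at hmid ⊢; linarith
      refine ⟨h2, ?_⟩
      obtain ⟨n, hn⟩ := hsum
      refine ⟨n, ?_⟩
      have : c - 1 = 2 * n := by
        refine mul_left_cancel₀ ha.ne' ?_
        linear_combination h2 + 2 * hn
      omega
    · right; right; left
      obtain ⟨l, hl⟩ := hY.resolve_left (by omega)
      obtain rfl : W = 3 + l * k := by linarith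
      rw [show 3 + l * k - 1 - 1 = 1 + l * k by ring, show 3 + l * k - 1 = 2 + l * k by ring,
        cdiv_add_mul hk0, cdiv_two hk, cdiv_add_mul hk0, cdiv_one hk0] at hmid
      refine ⟨l, h, ?_, by omega, by linear_combination -har,
        hsum.trans (dvd_of_eq (by ring)), by linear_combination hmid⟩
      by_contra hl0
      have : l * k ≤ -1 * k := mul_le_mul_of_nonneg_right (by omega) hk0.le
      omega
  · right; right; right; left
    obtain rfl : W = 2 * k + 1 + l * k := by linarith
    rw [show 2 * k + 1 + l * k - (2 * k - 1) - 1 = 1 + l * k by ring,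
      show 2 * k + 1 + l * k - k = 1 + (l + 1) * k by ring,
      cdiv_add_mul hk0, cdiv_one hk0, cdiv_add_mul hk0, cdiv_one hk0] at hmid
    refine ⟨l + 2, h - 1, ?_, by omega, by linear_combination -har,
        hsum.trans (dvd_of_eq (by ring)), by linear_combination hmid⟩
    by_contra hl0
    have : l * k ≤ -1 * k := mul_le_mul_of_nonneg_right (by omega) hk0.le
    omega

theorem IsPseudoSymmetric.pseudoSymmetricParams {a d k c : ℤ}
    (ha : 0 < a) (hd : 0 < d) (hc : 0 < c) (hk : 2 ≤ k) (hg : IsCoprime a d)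
    (hS : IsPseudoSymmetric (AASemigroup a d k c)) : PseudoSymmetricParams a d k c := by
  have hk0 : 0 < k := by omega
  obtain ⟨W, w, H, h, hL⟩ := exists_lShape ha hd hc hk0 hg
  obtain ⟨Y, Z, y₀, z₀, hP⟩ := IsPseudoSymmetric.exists_paired hL ha hd hc hk0 hg hS
  rcases hP.below_top hL ha hk hg with ⟨rfl, rfl, rfl, rfl⟩ | ⟨hY, hle⟩
  · exact pseudoSymmetricParams_of_top_eq_two hP hL ha hd hc hk hg
  · rcases hP.corner hL ha hd hc hk0 with ⟨rfl, rfl, hcor⟩ | ⟨rfl, rfl, hcor⟩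
    · exact pseudoSymmetricParams_of_right_corner hP hL ha hk hg hcor hY hle
    · exact pseudoSymmetricParams_of_upper_corner hP hL ha hk hg hcor hY hle

/-! ### All parameters occur -/

theorem le_weight {a d k c y z : ℤ} (ha : 0 < a) (hd : 0 < d) (hc : 0 < c) (hk : 0 < k)
    (hy : 1 ≤ y) (hz : 0 ≤ z) : a ≤ weight a d k c y z := by
  have h1 := cdiv_mono hk hy
  rw [cdiv_one hk] at h1
  have h2 := mul_le_mul_of_nonneg_left h1 ha.le
  have h3 : 0 < d * y := by positivity
  have h4 : 0 ≤ c * z := by positivity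
  unfold weight
  linarith

theorem weight_add_weight_sub {a d k c Y Z y z : ℤ} (hk : 0 < k) (hY : k ∣ Y - 1) :
    weight a d k c y z + weight a d k c (Y - y) (Z - z) = weight a d k c Y Z := by
  have := cdiv_add_cdiv_sub (y := y) hk hY
  unfold weight
  linear_combination a * this

theorem Paired.of_right_corner {a d k c W w H y₀ : ℤ} (ha : 0 < a) (hd : 0 < d) (hc : 0 < c)
    (hk : 0 < k) (hH : 2 ≤ H) (hw : 0 ≤ w) (hW : 2 ≤ W) (hWk : k ∣ W - 2)
    (hy₀ : 0 ≤ y₀) (hy₀' : y₀ < W - w)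
    (hmid : 2 * weight a d k c y₀ (H - 1) = weight a d k c (W - 1) (H - 2) + a)
    (hrow : ∀ y, 0 ≤ y → y < W - w → y ≠ y₀ → weight a d k c y (H - 1) +
      weight a d k c (W - w - 1 - y) (H - 1) = weight a d k c (W - 1) (H - 2)) :
    Paired a d k c W w H 1 (W - 1) (H - 2) y₀ (H - 1) := by
  refine ⟨by unfold LRegion; omega, by unfold LRegion; omega, hmid, ?_, ?_⟩
  · have := le_weight (a := a) (d := d) (k := k) (c := c) (y := W - 1) (z := H - 2) ha hd hc hk
      (by omega) (by omega)
    linarith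
  · rintro y z ⟨p0, p1, p2, p3, p4⟩ hne
    by_cases hz : z = H - 1
    · subst hz
      exact ⟨W - w - 1 - y, H - 1, by unfold LRegion; omega,
        hrow y p0 (by omega) (by simpa using hne)⟩
    · exact ⟨W - 1 - y, H - 2 - z, by unfold LRegion; omega,
        weight_add_weight_sub hk (hWk.trans (dvd_of_eq (by ring)))⟩

theorem Paired.of_upper_corner {a d k c W w H y₀ : ℤ} (ha : 0 < a) (hd : 0 < d) (hc : 0 < c)
    (hk : 0 < k) (hH : 1 ≤ H) (hw : 0 ≤ w) (hW : 2 ≤ W - w) (hWk : k ∣ W - w - 2)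
    (hy₀ : W - w ≤ y₀) (hy₀' : y₀ < W)
    (hmid : 2 * weight a d k c y₀ 0 = weight a d k c (W - w - 1) (H - 1) + a)
    (hrow : ∀ y, W - w ≤ y → y < W → y ≠ y₀ → weight a d k c y 0 +
      weight a d k c (2 * W - w - 1 - y) 0 = weight a d k c (W - w - 1) (H - 1)) :
    Paired a d k c W w H (H - 1) (W - w - 1) (H - 1) y₀ 0 := by
  refine ⟨by unfold LRegion; omega, by unfold LRegion; omega, hmid, ?_, ?_⟩
  · exact le_weight ha hd hc hk (by omega) le_rfl
  · rintro y z ⟨p0, p1, p2, p3, p4⟩ hne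
    by_cases hy : y < W - w
    · exact ⟨W - w - 1 - y, H - 1 - z, by unfold LRegion; omega,
        weight_add_weight_sub hk (hWk.trans (dvd_of_eq (by ring)))⟩
    · obtain rfl : z = 0 := by omega
      exact ⟨2 * W - w - 1 - y, 0, by unfold LRegion; omega,
        hrow y (by omega) (by omega) (by simpa using hne)⟩

/-- Taking k = 2 and the redundant generator c = 3, the region is the row of three points with the
exceptional one in the middle. -/
theorem isPseudoSymmetric_closure_triple {d : ℤ} (hd : 0 < d) (h3 : ¬ 3 ∣ d) :
    IsPseudoSymmetric (AddSubmonoid.closure {3, 3 + d, 3 + 2 * d}) := by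
  have hg : IsCoprime (3 : ℤ) d := (Int.prime_three.coprime_iff_not_dvd).2 h3
  rw [← AASemigroup.eq_closure_triple (k := 2) (c := 3) (n := 1) (r := 0) hd le_rfl le_rfl
    (by norm_num) (by norm_num) (Or.inl rfl) (by ring)]
  have hL : LShape 3 d 2 3 3 0 1 0 :=
    ⟨by norm_num, by norm_num, by norm_num, by norm_num, by norm_num, by simp, by simp,
      by linarith, by norm_num⟩
  refine hL.isPseudoSymmetric (Y := 2) (Z := 0) (y₀ := 1) (z₀ := 0) (by norm_num) hd (by norm_num)
    (by norm_num) hg ⟨by unfold LRegion; omega, by unfold LRegion; omega, ?_, ?_, ?_⟩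
  · unfold weight
    rw [cdiv_one (by norm_num), cdiv_two le_rfl]
    ring
  · exact le_weight (by norm_num) hd (by norm_num) (by norm_num) le_rfl le_rfl
  · rintro y z ⟨p0, p1, p2, p3, -⟩ hne
    refine ⟨2 - y, 0, by unfold LRegion; omega, ?_⟩
    obtain rfl : z = 0 := by omega
    have : y = 0 ∨ y = 2 := by omega
    rcases this with rfl | rfl <;> simp [weight]

theorem isPseudoSymmetric_of_odd {a d k c : ℤ} (ha : 0 < a) (hd : 0 < d) (hc : 0 < c) (hk : 2 ≤ k)
    (hg : IsCoprime a d) (h : a * (c - 1) = 2 * (c + d)) (hodd : Odd c) :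
    IsPseudoSymmetric (AASemigroup a d k c) := by
  have hk0 : 0 < k := by omega
  obtain ⟨n, rfl⟩ := hodd
  have hn : 2 * n + 1 + d = a * n := by linarith
  have hn1 : 1 ≤ n := by
    by_contra hn0
    have : n = 0 := by omega
    subst this
    omega
  have ha3 : 3 ≤ a := by
    by_contra h3
    have : a * n ≤ 2 * n := mul_le_mul_of_nonneg_right (by omega) (by omega)
    omega
  have hca : (2 * n + 1) * (a - 2) = a + 2 * d := by linarith
  have hL : LShape a d k (2 * n + 1) 3 2 (a - 2) (a - 3) := by
    refine ⟨by norm_num, by norm_num, by omega, by omega, by ring, ⟨n - 1, ?_⟩,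
      ⟨1, by linarith⟩, ?_, ?_⟩
    · linear_combination hn - hca
    · have h1 : 0 ≤ k * a * (n - 1) := by
        have : 0 ≤ n - 1 := by omega
        positivity
      have h2 : k * (2 * n + 1) * (a - 3) = k * (a + 2 * d - (2 * n + 1)) := by rw [← hca]; ring
      rw [h2]
      have h3 : k * (2 * n + 1 + d) = k * (a * n) := by rw [hn]
      linarith
    · have h2 : k * (2 * n + 1) * (a - 2) = k * (a + 2 * d) := by rw [← hca]; ring
      rw [h2]
      have : 0 ≤ (k - 2) * a := mul_nonneg (by omega) ha.le
      linarith
  refine hL.isPseudoSymmetric (Y := 2) (Z := 0) (y₀ := 1) (z₀ := 0) ha hd hc hk0 hg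
    ⟨by unfold LRegion; omega, by unfold LRegion; omega, ?_, ?_, ?_⟩
  · unfold weight
    rw [cdiv_one hk0, cdiv_two hk]
    ring
  · exact le_weight ha hd hc hk0 le_rfl le_rfl
  · rintro y z ⟨p0, p1, p2, p3, p4⟩ hne
    by_cases hz : z = 0
    · subst hz
      refine ⟨2 - y, 0, by unfold LRegion; omega, ?_⟩
      have : y = 0 ∨ y = 2 := by omega
      rcases this with rfl | rfl <;> simp [weight]
    · obtain rfl : y = 0 := by omega
      refine ⟨0, a - 2 - z, by unfold LRegion; omega, ?_⟩
      unfold weight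
      rw [cdiv_zero_left, cdiv_two hk]
      linear_combination hca

theorem isPseudoSymmetric_of_upper_one {a d k c l m : ℤ} (ha : 0 < a) (hd : 0 < d) (hc : 0 < c)
    (hk : 2 ≤ k) (hg : IsCoprime a d) (hl : 0 ≤ l) (hm : 1 ≤ m)
    (h1 : a = (2 + l * k) * (m + 1) + 1) (h2 : a ∣ c + (2 + l * k) * d)
    (h3 : l * (a + k * d) = c * m - 3 * d) : IsPseudoSymmetric (AASemigroup a d k c) := by
  have hk0 : 0 < k := by omega
  have hlk : 0 ≤ l * k := by positivity
  have hle : a ≤ c + (2 + l * k) * d := Int.le_of_dvd (by positivity) h2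
  obtain ⟨n, hn⟩ := h2
  have hL : LShape a d k c (3 + l * k) 1 (m + 1) (m + 1 - 1) := by
    refine ⟨by norm_num, by omega, by omega, by omega, by linear_combination -h1,
      ⟨-l, by linear_combination h3⟩, ⟨l + n, by linear_combination hn - h3⟩, ?_, ?_⟩
    · have : (a + k * d) * (3 + l * k) - k * c * (m + 1 - 1) = 3 * a := by
        linear_combination k * h3
      omega
    · have : k * c * (m + 1) - (a + k * d) * 1 =
          k * (l * a) + ((k - 1) * (c + (2 + l * k) * d) + (c + (2 + l * k) * d - a)) := by
        linear_combination -k * h3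
      rw [this]
      have h4 : 0 ≤ (k - 1) * (c + (2 + l * k) * d) := mul_nonneg (by omega) (by positivity)
      have h5 : 0 ≤ k * (l * a) := by positivity
      omega
  refine hL.isPseudoSymmetric ha hd hc hk0 hg
    (Paired.of_upper_corner (y₀ := 2 + l * k) ha hd hc hk0 (by omega) (by omega) (by omega)
      ⟨l, by ring⟩ (by omega) (by omega) ?_ ?_)
  · rw [show 3 + l * k - 1 - 1 = 1 + l * k by ring]
    unfold weight
    rw [cdiv_add_mul hk0, cdiv_two hk, cdiv_add_mul hk0, cdiv_one hk0]
    linear_combination h3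
  · intro y hy hy' hne
    omega

theorem isPseudoSymmetric_of_upper_long {a d k c l v : ℤ} (ha : 0 < a) (hd : 0 < d) (hc : 0 < c)
    (hk : 2 ≤ k) (hg : IsCoprime a d) (hl : 2 ≤ l) (hv : 0 ≤ v)
    (h1 : a = (v + 1) * (2 + (l - 2) * k) + (l * k + 1)) (h2 : a ∣ c + (2 + (l - 2) * k) * d)
    (h3 : l * (a + k * d) = c * (v + 1) - d) : IsPseudoSymmetric (AASemigroup a d k c) := by
  have hk0 : 0 < k := by omega
  obtain ⟨j, rfl⟩ : ∃ j, l = j + 2 := ⟨l - 2, by ring⟩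
  rw [show j + 2 - 2 = j by ring] at h1 h2
  have hjk : 0 ≤ j * k := mul_nonneg (by omega) hk0.le
  obtain ⟨n, hn⟩ := h2
  have hn0 : 0 < a * n := by rw [← hn]; positivity
  have hL : LShape a d k c (2 * k + 1 + j * k) (2 * k - 1) (v + 2) (v + 2 - 1) := by
    refine ⟨by omega, by omega, by omega, by omega, by linear_combination -h1,
      ⟨-(j + 2), by linear_combination h3⟩, ⟨j + 2 + n, by linear_combination hn - h3⟩, ?_, ?_⟩
    · have : (a + k * d) * (2 * k + 1 + j * k) - k * c * (v + 2 - 1) = a := by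
        linear_combination k * h3
      omega
    · have : k * c * (v + 2) - (a + k * d) * (2 * k - 1) =
          a * (j * k + 1) + k * (a * n) := by
        linear_combination -k * h3 + k * hn
      rw [this]
      positivity
  refine hL.isPseudoSymmetric ha hd hc hk0 hg
    (Paired.of_upper_corner (y₀ := 1 + (j + 1) * k) ha hd hc hk0 (by omega) (by omega)
      (by omega) ⟨j, by ring⟩ (by linarith) (by linarith) ?_ ?_)
  · rw [show 2 * k + 1 + j * k - (2 * k - 1) - 1 = 1 + j * k by ring]
    unfold weight
    rw [cdiv_add_mul hk0, cdiv_one hk0, cdiv_add_mul hk0, cdiv_one hk0]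
    linear_combination h3
  · intro y hy hy' hne
    rw [show 2 * k + 1 + j * k - (2 * k - 1) - 1 = 1 + j * k by ring]
    -- Left of the centre all ceilings are j + 1 and right of it j + 2, so each pair falls one short
    -- of twice the central value j + 2.
    have key : cdiv y k + cdiv (2 * (2 * k + 1 + j * k) - (2 * k - 1) - 1 - y) k = 2 * j + 3 := by
      have hlow : ∀ x, 1 + j * k < x → x < 1 + (j + 1) * k → cdiv x k = j + 1 := fun x hx hx' =>
        cdiv_eq hk0 (by linarith) (by linarith)
      have hupp : ∀ x, 1 + (j + 1) * k < x → x < 1 + (j + 2) * k → cdiv x k = j + 2 :=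
        fun x hx hx' => cdiv_eq hk0 (by linarith) (by linarith)
      rcases lt_or_gt_of_ne hne with hlt | hlt
      · rw [hlow y (by linarith) hlt, hupp _ (by linarith) (by linarith)]
        ring
      · rw [hupp y hlt (by linarith), hlow _ (by linarith) (by linarith)]
        ring
    unfold weight
    rw [cdiv_add_mul hk0, cdiv_one hk0]
    linear_combination a * key + h3

theorem isPseudoSymmetric_of_right_one {a d k c q R s : ℤ} (ha : 0 < a) (hd : 0 < d) (hc : 0 < c)
    (hk : 2 ≤ k) (hg : IsCoprime a d) (hq : 2 ≤ q) (hR : R ≡ 2 [ZMOD k]) (hs : s ≡ 2 [ZMOD k])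
    (h1 : a = (q - 1) * s + 1) (h2 : a + k * d = q * R + 2 * k - 1)
    (h3 : k * c = (R + 2 * k - 1) * (s - 1) + 2 * k - 1) :
    IsPseudoSymmetric (AASemigroup a d k c) := by
  have hk0 : 0 < k := by omega
  obtain ⟨i, hi⟩ := hR.symm.dvd
  obtain ⟨j, hj⟩ := hs.symm.dvd
  obtain rfl : R = 2 + i * k := by linarith
  obtain rfl : s = 2 + j * k := by linarith
  have hj0 : 0 ≤ j := by
    by_contra hj0
    have hjk : j * k ≤ -1 * k := mul_le_mul_of_nonneg_right (by omega) hk0.le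
    have hs0 : 2 + j * k = 0 := by
      by_contra hne
      have : (q - 1) * (2 + j * k) ≤ 1 * (2 + j * k) :=
        mul_le_mul_of_nonpos_right (by omega) (by omega)
      omega
    rw [hs0] at h1 h3
    have hkc : k * 1 ≤ k * c := mul_le_mul_of_nonneg_left (by omega) hk0.le
    have hR0 : q * (2 + i * k) ≤ 2 * (2 + i * k) :=
      mul_le_mul_of_nonpos_right hq (by linarith)
    have hkd : 0 < k * d := by positivity
    linarith
  have hjk : 0 ≤ j * k := by positivity
  have hi0 : 0 ≤ i := by
    by_contra hi0
    have hik : i * k ≤ -1 * k := mul_le_mul_of_nonneg_right (by omega) hk0.le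
    have h4 : q * (2 + i * k) ≤ q * (2 - k) := mul_le_mul_of_nonneg_left (by linarith) (by omega)
    have h5 : (q - 1) * 2 ≤ (q - 1) * (2 + j * k) :=
      mul_le_mul_of_nonneg_left (by linarith) (by omega)
    have h6 : k * 1 ≤ k * d := mul_le_mul_of_nonneg_left (by omega) hk0.le
    have h7 : 2 * k ≤ q * k := mul_le_mul_of_nonneg_right hq hk0.le
    linarith
  have hE₁ : c * q = d * (1 + j * k) + a * (j + 2) := by
    refine mul_left_cancel₀ hk0.ne' ?_
    linear_combination q * h3 - (1 + j * k) * h2 - (2 * k - 1) * h1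
  have hE₂ : d * (2 + j * k) - c = a * (i - j) := by
    refine mul_left_cancel₀ hk0.ne' ?_
    linear_combination (2 + j * k) * h2 - h3 - (2 + i * k) * h1
  have hL : LShape a d k c (2 + j * k) (1 + j * k) q 1 := by
    refine ⟨by omega, by omega, by norm_num, by omega, by linear_combination -h1,
      ⟨i - j, by linear_combination hE₂⟩, ⟨j + 2, by linear_combination hE₁⟩, ?_, ?_⟩
    · have : (a + k * d) * (2 + j * k) - k * c * 1 = a * (2 + i * k) := by
        linear_combination k * hE₂
      rw [this]
      positivity
    · have : k * c * q - (a + k * d) * (1 + j * k) = a * (2 * k - 1) := by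
        linear_combination k * hE₁
      rw [this]
      exact mul_nonneg ha.le (by omega)
  refine hL.isPseudoSymmetric ha hd hc hk0 hg
    (Paired.of_right_corner (y₀ := 0) ha hd hc hk0 hq (by omega) (by omega)
      ⟨j, by ring⟩ (by omega) (by omega) ?_ ?_)
  · rw [show 2 + j * k - 1 = 1 + j * k by ring]
    unfold weight
    rw [cdiv_zero_left, cdiv_add_mul hk0, cdiv_one hk0]
    linear_combination hE₁
  · intro y hy hy' hne
    omega

theorem isPseudoSymmetric_of_right_three {a d k c q R s : ℤ} (ha : 0 < a) (hd : 0 < d)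
    (hc : 0 < c) (hk : 2 ≤ k) (hg : IsCoprime a d) (hq : 2 ≤ q) (hR : R ≡ 2 [ZMOD k])
    (hs : s ≡ 2 [ZMOD k]) (hs2 : s ≠ 2) (h1 : a = (q - 1) * s + 3) (h2 : a + k * d = q * R + 1)
    (h3 : k * c = (R + 1) * (s - 3) + 3) : IsPseudoSymmetric (AASemigroup a d k c) := by
  have hk0 : 0 < k := by omega
  obtain ⟨i, hi⟩ := hR.symm.dvd
  obtain ⟨j, hj⟩ := hs.symm.dvd
  obtain rfl : R = 2 + i * k := by linarith
  obtain rfl : s = 2 + j * k := by linarith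
  have hR0 : 0 < 2 + i * k := by
    by_contra hneg
    have h4 : q * (2 + i * k) ≤ 0 := mul_nonpos_of_nonneg_of_nonpos (by omega) (by omega)
    have h5 : 2 * 1 ≤ k * d := mul_le_mul hk (by omega) (by norm_num) hk0.le
    omega
  have hi0 : 0 ≤ i := by
    by_contra hi0
    have hik : i * k ≤ -1 * k := mul_le_mul_of_nonneg_right (by omega) hk0.le
    omega
  -- The case j = 0 is s = 2, where w = j k - 1 would be negative.
  have hj0 : 1 ≤ j := by
    by_contra hj0
    have hj1 : j ≠ 0 := by
      rintro rfl
      simp at hs2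
    have hjk : j * k ≤ -1 * k := mul_le_mul_of_nonneg_right (by omega) hk0.le
    have h4 : (2 + i * k + 1) * (2 + j * k - 3) ≤ (2 + i * k + 1) * (-3) :=
      mul_le_mul_of_nonneg_left (by linarith) (by omega)
    have h5 : 0 < k * c := by positivity
    omega
  have hjk : 1 * k ≤ j * k := mul_le_mul_of_nonneg_right hj0 hk0.le
  have hE₁ : c * q = d * (j * k - 1) + a * j := by
    refine mul_left_cancel₀ hk0.ne' ?_
    linear_combination q * h3 - (j * k - 1) * h2 - h1
  have hE₂ : d * (2 + j * k) - c = a * (i - j) := by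
    refine mul_left_cancel₀ hk0.ne' ?_
    linear_combination (2 + j * k) * h2 - h3 - (2 + i * k) * h1
  have hL : LShape a d k c (2 + j * k) (j * k - 1) q 1 := by
    refine ⟨by omega, by omega, by norm_num, by omega, by linear_combination -h1,
      ⟨i - j, by linear_combination hE₂⟩, ⟨j, by linear_combination hE₁⟩, ?_, ?_⟩
    · have : (a + k * d) * (2 + j * k) - k * c * 1 = a * (2 + i * k) := by
        linear_combination k * hE₂
      rw [this]
      positivity
    · have : k * c * q - (a + k * d) * (j * k - 1) = a := by
        linear_combination k * hE₁
      omega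
  refine hL.isPseudoSymmetric ha hd hc hk0 hg
    (Paired.of_right_corner (y₀ := 1) ha hd hc hk0 hq (by omega) (by omega)
      ⟨j, by ring⟩ (by omega) (by omega) ?_ ?_)
  · rw [show 2 + j * k - 1 = 1 + j * k by ring]
    unfold weight
    rw [cdiv_add_mul hk0, cdiv_one hk0]
    linear_combination hE₁
  · intro y hy hy' hne
    rw [show 2 + j * k - 1 = 1 + j * k by ring, show 2 + j * k - (j * k - 1) - 1 - y = 2 - y by ring]
    have : y = 0 ∨ y = 2 := by omega
    unfold weight
    rcases this with rfl | rfl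
    · rw [sub_zero, cdiv_zero_left, cdiv_two hk, cdiv_add_mul hk0, cdiv_one hk0]
      linear_combination hE₁
    · rw [sub_self, cdiv_zero_left, cdiv_two hk, cdiv_add_mul hk0, cdiv_one hk0]
      linear_combination hE₁

theorem PseudoSymmetricParams.isPseudoSymmetric {a d k c : ℤ} (ha : 0 < a) (hd : 0 < d)
    (hc : 0 < c) (hk : 2 ≤ k) (hg : IsCoprime a d) (h : PseudoSymmetricParams a d k c) :
    IsPseudoSymmetric (AASemigroup a d k c) := by
  rcases h with h | ⟨h, hodd⟩ | ⟨l, m, hl, hm, h1, h2, h3⟩ | ⟨l, v, hl, hv, h1, h2, h3⟩ |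
    ⟨q, R, s, hq, hR, hs, h1, h2, h3⟩ | ⟨q, R, s, hq, hR, hs, hs2, h1, h2, h3⟩
  · have h3 : ¬ 3 ∣ d := by
      intro h3
      have hall : ∀ x ∈ AddSubmonoid.closure ({3, 3 + d, 3 + 2 * d} : Set ℤ), 3 ∣ x := by
        intro x hx
        induction hx using AddSubmonoid.closure_induction with
        | mem x hx => rcases hx with rfl | rfl | rfl <;> omega
        | zero => exact dvd_zero _
        | add x y _ _ hx hy => exact dvd_add hx hy
      have ha3 : 3 ∣ a := hall a (h ▸ AddSubmonoid.subset_closure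
        (Or.inl ⟨0, le_rfl, by omega, by ring⟩))
      have := hg.isUnit_of_dvd' ha3 h3
      rw [Int.isUnit_iff] at this
      omega
    rw [h]
    exact isPseudoSymmetric_closure_triple hd h3
  · exact isPseudoSymmetric_of_odd ha hd hc hk hg h hodd
  · exact isPseudoSymmetric_of_upper_one ha hd hc hk hg hl hm h1 h2 h3
  · exact isPseudoSymmetric_of_upper_long ha hd hc hk hg hl hv h1 h2 h3
  · exact isPseudoSymmetric_of_right_one ha hd hc hk hg hq hR hs h1 h2 h3
  · exact isPseudoSymmetric_of_right_three ha hd hc hk hg hq hR hs hs2 h1 h2 h3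

theorem isPseudoSymmetric_iff {a d k c : ℤ} (ha : 0 < a) (hd : 0 < d) (hc : 0 < c) (hk : 2 ≤ k) :
    IsPseudoSymmetric (AASemigroup a d k c) ↔
      Int.gcd a d = 1 ∧ PseudoSymmetricParams a d k c := by
  constructor
  · intro h
    have hg := IsPseudoSymmetric.gcd_eq_one ha hc (by omega) h
    exact ⟨hg, h.pseudoSymmetricParams ha hd hc hk (Int.isCoprime_iff_gcd_eq_one.2 hg)⟩
  · rintro ⟨hg, h⟩
    exact h.isPseudoSymmetric ha hd hc hk (Int.isCoprime_iff_gcd_eq_one.2 hg)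

/-! ### The case of a top row of length one with small width -/

/-- This is the value λ = 0 of family (c.2). If 3 ∣ m, then 3 would divide both a and d; so c = 3 e
and d = e m, which makes c + 2 d = e a. The bound on a follows from m ≤ d and k ≥ 2. -/
theorem upper_one_zero_iff {a d k c : ℤ} (ha : 0 < a) (hd : 0 < d) (hc : 0 < c) (hk : 2 ≤ k)
    (hg : IsCoprime a d) :
    (∃ m : ℤ, 1 ≤ m ∧ a = 2 * (m + 1) + 1 ∧ a ∣ c + 2 * d ∧ 0 = c * m - 3 * d) ↔
      (a ≡ 1 [ZMOD 6] ∨ a ≡ 5 [ZMOD 6]) ∧ c * (a - 3) = 6 * d ∧ a ≤ 2 * k * d + 3 := by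
  have h3c : ∀ m, a = 2 * (m + 1) + 1 → c * m = 3 * d → ¬ 3 ∣ m → ∃ e, c = 3 * e ∧ d = e * m := by
    intro m _ hcm hm
    have : (3 : ℤ) ∣ c := (Int.prime_three.dvd_or_dvd ⟨d, hcm⟩).resolve_right hm
    obtain ⟨e, rfl⟩ := this
    exact ⟨e, rfl, by linarith⟩
  constructor
  · rintro ⟨m, hm, h1, h2, h3⟩
    have hcm : c * m = 3 * d := by linarith
    have hm3 : ¬ 3 ∣ m := by
      rintro ⟨n, rfl⟩
      have hd' : d = c * n := by linarith
      obtain ⟨e, he⟩ := h2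
      have hc3 : c = 3 * e := by
        have h0 : 2 * n + 1 ≠ 0 := by omega
        refine mul_left_cancel₀ h0 ?_
        rw [h1] at he
        linear_combination he - 2 * hd'
      have := hg.isUnit_of_dvd' (x := 3) ⟨2 * n + 1, by linarith⟩ ⟨e * n, by rw [hd', hc3]; ring⟩
      rw [Int.isUnit_iff] at this
      omega
    obtain ⟨e, rfl, rfl⟩ := h3c m h1 hcm hm3
    refine ⟨?_, by rw [h1]; ring, ?_⟩
    · unfold Int.ModEq
      omega
    · have he : 1 ≤ e := by omega
      have h4 : 1 * m ≤ e * m := mul_le_mul_of_nonneg_right he (by omega)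
      have h5 : 2 * (e * m) ≤ k * (e * m) := mul_le_mul_of_nonneg_right hk hd.le
      linarith
  · rintro ⟨h1, h2, -⟩
    unfold Int.ModEq at h1
    obtain ⟨m, hm⟩ : ∃ m, a = 2 * (m + 1) + 1 := ⟨(a - 3) / 2, by omega⟩
    have hcm : c * m = 3 * d := by rw [hm] at h2; linarith
    have hm0 : 1 ≤ m := by
      by_contra hm0
      have : c * m ≤ 0 := mul_nonpos_of_nonneg_of_nonpos hc.le (by omega)
      omega
    obtain ⟨e, rfl, rfl⟩ := h3c m hm hcm (by omega)
    exact ⟨m, hm0, hm, ⟨e, by rw [hm]; ring⟩, by ring⟩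

/-! ### Semigroups with many generators -/

/-- The least positive element is k + 2, so elements below 2k + 4 are not sums of two positive ones,
and every generating set contains the k - 1 progression members in that range. -/
theorem le_card_of_closure_eq {k : ℤ} (hk : 2 ≤ k) (T : Finset ℤ)
    (hT : AddSubmonoid.closure (T : Set ℤ) = AASemigroup (k + 5) 1 k (k + 2)) :
    k - 1 ≤ T.card := by
  have hk0 : 0 < k := by omega
  have hS : ∀ x ∈ AASemigroup (k + 5) 1 k (k + 2), x = 0 ∨ k + 2 ≤ x := by
    intro x hx
    induction hx using AddSubmonoid.closure_induction with
    | mem x hx => rcases hx with ⟨i, h0, -, rfl⟩ | rfl <;> omega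
    | zero => exact Or.inl rfl
    | add x y _ _ hx hy => omega
  have hirr : ∀ x ∈ AddSubmonoid.closure (T : Set ℤ), x = 0 ∨ x ∈ T ∨ 2 * k + 4 ≤ x := by
    intro x hx
    induction hx using AddSubmonoid.closure_induction with
    | mem x hx => exact Or.inr (Or.inl hx)
    | zero => exact Or.inl rfl
    | add x y hx hy ihx ihy =>
      rcases hS x (hT ▸ hx) with rfl | hx'
      · simpa using ihy
      · rcases hS y (hT ▸ hy) with rfl | hy'
        · simpa using ihx
        · right; right; omega
  have hsub : Finset.Ico (k + 5) (2 * k + 4) ⊆ T := by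
    intro x hx
    rw [Finset.mem_Ico] at hx
    have hmem : x ∈ AddSubmonoid.closure (T : Set ℤ) := by
      rw [hT]
      exact AddSubmonoid.subset_closure (Or.inl ⟨x - (k + 5), by omega, by omega, by ring⟩)
    rcases hirr x hmem with h | h | h
    · omega
    · exact h
    · omega
  have := Finset.card_le_card hsub
  rw [Int.card_Ico] at this
  omega

theorem theorem4p8 :
    (∀ a d c k : ℤ, 0 < a → 0 < d → 0 < c → 2 ≤ k →
      (IsPseudoSymmetric (AASemigroup a d k c) ↔
        Int.gcd a d = 1 ∧
        ( -- (a)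
          (AASemigroup a d k c = AddSubmonoid.closure {3, 3 + d, 3 + 2 * d}) ∨
          -- (b)
          (a * (c - 1) = 2 * (c + d) ∧ Odd c) ∨
          -- (c.1)
          ((a ≡ 1 [ZMOD 6] ∨ a ≡ 5 [ZMOD 6]) ∧ c * (a - 3) = 6 * d ∧ a ≤ 2 * k * d + 3) ∨
          -- (c.2)
          (∃ l μ m : ℤ, 1 ≤ l ∧ 1 ≤ μ ∧ 1 ≤ m ∧
            a = (2 + l * k) * (m + 1) + 1 ∧
            c + (2 + l * k) * d = μ * a ∧
            (a + k * d : ℚ) = (c * m - 3 * d : ℚ) / (l : ℚ)) ∨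
          -- (d)
          (∃ l μ v : ℤ, 2 ≤ l ∧ 1 ≤ μ ∧ 0 ≤ v ∧
            a = (v + 1) * (2 + (l - 2) * k) + (l * k + 1) ∧
            c + (2 + (l - 2) * k) * d = μ * a ∧
            (a + k * d : ℚ) = (c * (v + 1) - d : ℚ) / (l : ℚ)) ∨
          -- (e)
          (∃ q₁ R₀ s₀ : ℤ, 2 ≤ q₁ ∧ R₀ ≡ 2 [ZMOD k] ∧ s₀ ≡ 2 [ZMOD k] ∧
            a = (q₁ - 1) * s₀ + 1 ∧
            a + k * d = q₁ * R₀ + 2 * k - 1 ∧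
            k * c = (R₀ + 2 * k - 1) * (s₀ - 1) + 2 * k - 1) ∨
          -- (f)
          (∃ q₁ R₀ s₀ : ℤ, 2 ≤ q₁ ∧ R₀ ≡ 2 [ZMOD k] ∧ s₀ ≡ 2 [ZMOD k] ∧ s₀ ≠ 2 ∧
            a = (q₁ - 1) * s₀ + 3 ∧
            a + k * d = q₁ * R₀ + 1 ∧
            k * c = (R₀ + 1) * (s₀ - 3) + 3)))) ∧
    -- pseudo-symmetric AA-semigroups need arbitrarily many generators
    (∀ n : ℕ, ∃ a d c k : ℤ, 0 < a ∧ 0 < d ∧ 0 < c ∧ 2 ≤ k ∧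
      IsPseudoSymmetric (AASemigroup a d k c) ∧
      ∀ T : Finset ℤ, AddSubmonoid.closure (T : Set ℤ) = AASemigroup a d k c → n ≤ T.card) := by
  refine ⟨fun a d c k ha hd hc hk => ?_, fun n => ?_⟩
  · rw [isPseudoSymmetric_iff ha hd hc hk]
    refine and_congr_right fun hg => ?_
    have hg' := Int.isCoprime_iff_gcd_eq_one.2 hg
    have hzero := upper_one_zero_iff ha hd hc hk hg'
    have hquot : ∀ l x : ℤ, l ≠ 0 → ((a + k * d : ℚ) = (x : ℚ) / (l : ℚ) ↔
        l * (a + k * d) = x) := by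
      intro l x hl
      have hl' : (l : ℚ) ≠ 0 := by exact_mod_cast hl
      rw [eq_div_iff hl', mul_comm]
      exact_mod_cast Iff.rfl
    have hmul : ∀ x : ℤ, 0 < x → (a ∣ x ↔ ∃ μ : ℤ, 1 ≤ μ ∧ x = μ * a) := by
      intro x hx
      constructor
      · rintro ⟨μ, rfl⟩
        exact ⟨μ, pos_of_mul_pos_right hx ha.le, by ring⟩
      · rintro ⟨μ, -, rfl⟩
        exact dvd_mul_left _ _
    unfold PseudoSymmetricParams
    refine or_congr_right (or_congr_right ?_)
    -- The integer family with l ≥ 0 splits into (c.1) for l = 0 and (c.2) for l ≥ 1.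
    refine Iff.trans (or_congr ?_ (or_congr_left ?_)) or_assoc
    · constructor
      · rintro ⟨l, m, hl, hm, h1, h2, h3⟩
        by_cases hl0 : l = 0
        · subst hl0
          exact Or.inl (hzero.1 ⟨m, hm, by simpa using h1, by simpa using h2, by simpa using h3⟩)
        · right
          obtain ⟨μ, hμ, he⟩ := (hmul _ (by positivity)).1 h2
          refine ⟨l, μ, m, by omega, hμ, hm, h1, he, ?_⟩
          have := (hquot l (c * m - 3 * d) hl0).2 h3
          push_cast at this
          exact this
      · rintro (h | ⟨l, μ, m, hl, hμ, hm, h1, h2, h3⟩)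
        · obtain ⟨m, hm, h1, h2, h3⟩ := hzero.2 h
          exact ⟨0, m, le_rfl, hm, by simpa using h1, by simpa using h2, by simpa using h3⟩
        · refine ⟨l, m, by omega, hm, h1, ⟨μ, by rw [h2]; ring⟩, ?_⟩
          refine (hquot l (c * m - 3 * d) (by omega)).1 ?_
          push_cast
          exact h3
    · constructor
      · rintro ⟨l, v, hl, hv, h1, h2, h3⟩
        have hl0 : 0 ≤ l - 2 := by omega
        obtain ⟨μ, hμ, he⟩ := (hmul _ (by positivity)).1 h2
        refine ⟨l, μ, v, hl, hμ, hv, h1, he, ?_⟩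
        have := (hquot l (c * (v + 1) - d) (by omega)).2 h3
        push_cast at this
        exact this
      · rintro ⟨l, μ, v, hl, hμ, hv, h1, h2, h3⟩
        refine ⟨l, v, hl, hv, h1, ⟨μ, by rw [h2]; ring⟩, ?_⟩
        refine (hquot l (c * (v + 1) - d) (by omega)).1 ?_
        push_cast
        exact h3
  · refine ⟨n + 2 + 5, 1, n + 2 + 2, n + 2, by positivity, by norm_num, by positivity, by omega,
      ?_, fun T hT => ?_⟩
    · rw [isPseudoSymmetric_iff (by positivity) (by norm_num) (by positivity) (by omega)]
      refine ⟨by simp, ?_⟩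
      unfold PseudoSymmetricParams
      right; right; right; right; right
      -- Family (f) with q₁ = 2 and R₀ = s₀ = k + 2, for k = n + 2, gives a = k + 5, d = 1 and c = k
      -- + 2.
      refine ⟨2, n + 2 + 2, n + 2 + 2, le_rfl, ?_, ?_, by omega, by ring, by ring, by ring⟩ <;>
        simp [Int.ModEq]
    · have := le_card_of_closure_eq (by omega) T hT
      omega
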